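/- A problem is a partial multifunction $f:\subseteq\mathbb N^{\mathbb N}\rightrightarrows\mathbb N^{\mathbb N}$. A realizer of $f$ is a partial function $F$ on $\mathbb N^{\mathbb N}$ with $F(x)\in f(x)$ for all $x\in\operatorname{dom}(f)$. We write $g\le_{\mathrm W} f$ if there are computable partial functionals $H,K$ on $\mathbb N^{\mathbb N}$ such that $x\mapsto K\langle F(H(x)),x\rangle$ is a realizer of $g$ whenever $F$ is a realizer of $f$, and $f\equiv_{\mathrm W} g$ if $f\le_{\mathrm W} g$ and $g\le_{\mathrm W} f$. Identify $k\in\mathbb N$ with $\{0,\dots,k-1\}$; a problem with codomain $k$ is a partial multifunction $f:\subseteq\mathbb N^{\mathbb N}\rightrightarrows k$, where $q\in\mathbb N^{\mathbb N}$ is a name of $j\in k$ if $q(0)=j$. The disjoint union $\bigsqcup_{n\in S} f_n$ ($S\subseteq\mathbb N$) maps $(n,x)$, with $n\in S$ and $x\in\operatorname{dom}(f_n)$, to the pairs $(n,y)$ with $y\in f_n(x)$. * $\mathsf{cRT}^1_k$: given $p\in k^{\mathbb N}$, find $j<k$ that occurs infinitely often in $p$. $\mathsf{cRT}^1_+=\bigsqcup_{k>0}\mathsf{cRT}^1_k$.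 * $\mathsf C_{2^{\mathbb N}}$ (closed choice on Cantor space): given an enumeration of words whose cylinders exhaust the complement of a nonempty closed set $A\subseteq 2^{\mathbb N}$, find a point of $A$. * The jump $f'$ of $f$: given a sequence in $\mathbb N^{\mathbb N}$ that converges to some $x\in\operatorname{dom}(f)$, find an element of $f(x)$. * The $k$-finitary part $\operatorname{Fin}_k(f)$: given $\langle w,p\rangle$, where $p\in\operatorname{dom}(f)$ and $w\in\mathbb N^{\mathbb N}$ codes a continuous partial functional $\Gamma_w:\subseteq\mathbb N^{\mathbb N}\to\mathbb N$ (the value $\Gamma_w(q)$ is $j$ if the first nonzero value of $w$ on codes of initial segments of $q$ is $j+1$) that is defined with value less than $k$ at every $q\in f(p)$, find an element of $\{\Gamma_w(q): q\in f(p)\}$. Moreover $\operatorname{Fin}(f)=\bigsqcup_{k\in\mathbb N}\operatorname{Fin}_k(f)$. **Theorem.** 1. For every $k\in\mathbb N$ and every problem $f$, $\operatorname{Fin}_k(f)$ represents the greatest Weihrauch degree of a problem with codomain $k$ that is Weihrauch reducible to $f$. 2. For every $k\in\mathbb N$, $\operatorname{Fin}_k(\mathsf C_{2^{\mathbb N}}')\equiv_{\mathrm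 W}\mathsf{cRT}^1_k$. 3. $\operatorname{Fin}(\mathsf C_{2^{\mathbb N}}')\equiv_{\mathrm W}\mathsf{cRT}^1_+$. 4. For all $k,m\in\mathbb N$, $\operatorname{Fin}_k(\mathsf{cRT}^1_m)\equiv_{\mathrm W}\mathsf{cRT}^1_{\min\{k,m\}}$. -/

import Mathlib

open Filter Topology

namespace Weihrauch

/-- Baire space `ℕ^ℕ`. -/
abbrev Baire : Type := ℕ → ℕ

/-- The initial segment of length `n` of a sequence. -/
def initSeg {α : Type} (p : ℕ → α) (n : ℕ) : List α :=
  (List.range n).map p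

/-- Computability of a partial functional `F :⊆ ℕ^ℕ → ℕ^ℕ`: some computable function `h` on finite
words, monotone for the prefix order, approximates `F p` from the initial segments of `p`, for
every `p` in the domain of `F`. (By monotonicity, the last clause says exactly that the words
`h (p ↾ m)`, for `m = 0, 1, …`, are initial segments of `F p` of unbounded length.) -/
def ComputableFunctional (F : Baire →. Baire) : Prop :=
  ∃ h : List ℕ → List ℕ, Computable h ∧
    (∀ σ τ : List ℕ, σ <+: τ → h σ <+: h τ) ∧
    ∀ p q : Baire, q ∈ F p → ∀ n : ℕ, ∃ m : ℕ, initSeg q n <+: h (initSeg p m)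

/-- A problem is a partial multifunction `f :⊆ ℕ^ℕ ⇉ ℕ^ℕ`; `f p` is the set of solutions of `p`,
and the domain consists of the `p` with `f p` nonempty. -/
abbrev Problem : Type := Baire → Set Baire

/-- The domain of a problem. -/
def Problem.dom (f : Problem) : Set Baire := {p | (f p).Nonempty}

/-- `F` is a realizer of `f`: for all `p ∈ dom f`, `F p` is defined and lies in `f p`. -/
def Realizes (F : Baire →. Baire) (f : Problem) : Prop :=
  ∀ p ∈ f.dom, ∃ q ∈ F p, q ∈ f p

/-- The pairing `⟨p, q⟩` on Baire space: `p` on even and `q` on odd places. -/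
def pair (p q : Baire) : Baire :=
  fun n => if n % 2 = 0 then p (n / 2) else q (n / 2)

/-- The partial functional `K⟨F H, id⟩`, mapping `x` to `K ⟨F (H x), x⟩`. -/
def compose (K F H : Baire →. Baire) : Baire →. Baire :=
  fun x => (H x).bind fun y => (F y).bind fun z => K (pair z x)

/-- Weihrauch reducibility `g ≤_W f`. -/
def Reducible (g f : Problem) : Prop :=
  ∃ H K : Baire →. Baire, ComputableFunctional H ∧ ComputableFunctional K ∧
    ∀ F : Baire →. Baire, Realizes F f → Realizes (compose K F H) g

/-- Weihrauch equivalence. -/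
def Equivalent (f g : Problem) : Prop := Reducible f g ∧ Reducible g f

infix:50 " ≤W " => Reducible
infix:50 " ≡W " => Equivalent

/-- A partial multifunction from Baire space into the finite set `k = {0, …, k - 1}`. -/
abbrev FinProblem (k : ℕ) : Type := Baire → Set (Fin k)

/-- A multifunction with codomain `k`, as a problem on names: `q` is a name of `j` if `q 0 = j`. -/
def FinProblem.toProblem {k : ℕ} (f : FinProblem k) : Problem :=
  fun p => {q | ∃ j ∈ f p, q 0 = (j : ℕ)}

/-- The sequence with its first entry removed. -/
def tail (p : Baire) : Baire := fun n => p (n + 1)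

/-- The disjoint union `⨆_{n ∈ S} f n`: an instance is `(n, x)` with `n ∈ S` and `x` an instance
of `f n`, a solution is `(n, y)` with `y` a solution of `x`. The pair `(n, x)` is the sequence
with first entry `n` and tail `x`. -/
def disjointUnion (S : Set ℕ) (f : ℕ → Problem) : Problem :=
  fun p => {q | p 0 ∈ S ∧ q 0 = p 0 ∧ tail q ∈ f (p 0) (tail p)}

/-- Ramsey's theorem for singletons with `k` colours: given `p ∈ k^ℕ`, find some `j < k` that
occurs infinitely often in `p`. -/
def cRT (k : ℕ) : FinProblem k :=
  fun p => {j | (∀ n, p n < k) ∧ ∃ᶠ n in atTop, p n = (j : ℕ)}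

/-- Ramsey's theorem for singletons where the number of colours is part of the input. -/
def cRTPlus : Problem :=
  disjointUnion {k | 0 < k} fun k => (cRT k).toProblem

/-- The closed subset of Cantor space with negative information `p`: its complement is the union
of the cylinders of the words `σ` such that `code(σ) + 1` is enumerated by `p`
(and an entry `0` of `p` removes nothing). -/
def closedSet (p : Baire) : Set (ℕ → Bool) :=
  {x | ∀ (n : ℕ) (σ : List Bool), p n = Encodable.encode σ + 1 → initSeg x σ.length ≠ σ}

/-- Closed choice on Cantor space: given negative information on a nonempty closed set, find
one of its points. -/
def closedChoiceCantor : Problem :=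
  fun p => {q | ∃ x ∈ closedSet p, q = fun n => (x n).toNat}

/-- The jump of a problem `f`: given (a code of) a sequence `p_0, p_1, …` that converges in Baire
space to an instance `x` of `f`, find a solution of `x`. -/
def jump (f : Problem) : Problem :=
  fun p => {q | ∃ x : Baire,
    Tendsto (fun (i : ℕ) (n : ℕ) => p (Nat.pair i n)) atTop (𝓝 x) ∧ q ∈ f x}

/-- `w`, read as a code of a continuous partial functional `ℕ^ℕ → ℕ`, has value `j` at `q`: the
first nonzero value of `w` on (codes of) initial segments of `q` is `j + 1`. -/
def HasValue (w q : Baire) (j : ℕ) : Prop :=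
  ∃ n : ℕ, w (Encodable.encode (initSeg q n)) = j + 1 ∧
    ∀ m < n, w (Encodable.encode (initSeg q m)) = 0

/-- A representative of the `k`-finitary part of `f`: an instance is a pair `⟨w, p⟩` where `p` is an
instance of `f` and `w` codes a functional with a value below `k` at every solution of `p`;
the solutions are the values at solutions of `p`. -/
def finPart (k : ℕ) (f : Problem) : FinProblem k :=
  fun x => {j | ∃ w p : Baire, x = pair w p ∧
    (∀ q ∈ f p, ∃ i < k, HasValue w q i) ∧ ∃ q ∈ f p, HasValue w q j}

/-- The finitary part of `f`, the disjoint union of all `k`-finitary parts. -/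
def finitaryPart (f : Problem) : Problem :=
  disjointUnion Set.univ fun k => (finPart k f).toProblem

/-- `h` represents the greatest Weihrauch degree of a problem with codomain `k` that is Weihrauch
reducible to `f`. -/
def IsGreatestFin (k : ℕ) (f h : Problem) : Prop :=
  (∃ g : FinProblem k, h ≡W g.toProblem) ∧ h ≤W f ∧
    ∀ g : FinProblem k, g.toProblem ≤W f → g.toProblem ≤W h

end Weihrauch

namespace Weihrauch

/-! Maximality of the finitary part is a matter of coding. Evaluating `Γ_w` at an `f`-solution is
computable (`finPart_reducible`). Conversely, if `H`, `K` reduce a problem with codomain `k` to `f`,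
then `q ↦ K⟨q, x⟩(0)` is a functional whose code is computable from `x` (`exists_code`), so the
finitary part can be asked directly for the final answer.

For `cRT k` below the jump of closed choice, consider the points starting with `1^j 0` where `j < k`
recurs forever. A cylinder is removed as soon as `j` fails to occur after some `N`; each such
failure is decided in the limit, which is what the jump provides. The first zero of a point of the
set names a colour (`fiberReducible_cRT_jump`). Maximality then gives the reduction to the finitary
part.

For the other direction, compactness of Cantor space makes "no point of the closed set has value
`j`" visible from finitely much information (`exists_forall_avoids`). The instance is known only as
a limit, so at stage `i` the colour is the value whose exclusion, judged by the `i`-th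
approximation, takes longest. A value that is truly excluded eventually loses against one that is
attained, so every recurring colour is attained (`not_excluded_of_frequently`).

Both reductions are uniform in `k` (`FiberReducible`), so they also pass to disjoint unions. The
statement on `cRT m` follows from maximality and the case of closed choice. -/

@[simp] theorem length_initSeg {α : Type} (p : ℕ → α) (n : ℕ) : (initSeg p n).length = n := by
  simp [initSeg]

theorem getElem?_initSeg {α : Type} (p : ℕ → α) {n i : ℕ} (h : i < n) :
    (initSeg p n)[i]? = some (p i) := by
  simp [initSeg, h]

theorem getD_initSeg {α : Type} (p : ℕ → α) {n i : ℕ} (h : i < n) (d : α) :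
    (initSeg p n).getD i d = p i := by
  simp [getElem?_initSeg p h]

theorem take_initSeg {α : Type} (p : ℕ → α) {m n : ℕ} (h : m ≤ n) :
    (initSeg p n).take m = initSeg p m := by
  simp [initSeg, ← List.map_take, List.take_range, h]

theorem initSeg_prefix {α : Type} (p : ℕ → α) {m n : ℕ} (h : m ≤ n) :
    initSeg p m <+: initSeg p n := by
  rw [← take_initSeg p h]; exact List.take_prefix _ _

theorem initSeg_congr {α : Type} {p q : ℕ → α} {n : ℕ} (h : ∀ i < n, p i = q i) :
    initSeg p n = initSeg q n := by
  apply List.map_congr_left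
  intro i hi
  exact h i (List.mem_range.1 hi)

theorem initSeg_eq_iff {α : Type} {p q : ℕ → α} {n : ℕ} :
    initSeg p n = initSeg q n ↔ ∀ i < n, p i = q i := by
  refine ⟨fun h i hi => ?_, initSeg_congr⟩
  have := getElem?_initSeg p hi
  rw [h, getElem?_initSeg q hi] at this
  exact (Option.some.inj this).symm

theorem initSeg_prefix_iff {α : Type} {p : ℕ → α} {n : ℕ} {l : List α} :
    initSeg p n <+: l ↔ ∀ i < n, l[i]? = some (p i) := by
  rw [List.prefix_iff_getElem?]
  simp [initSeg]

/-! ### Computable functionals as searches on initial segments -/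

/-- The first value of `f 0, f 1, …, f (s - 1)` that is defined. -/
def firstSome (f : ℕ → Option ℕ) (s : ℕ) : Option ℕ :=
  Nat.rec none (fun t o => o.casesOn (f t) some) s

theorem firstSome_eq_none {f : ℕ → Option ℕ} {s : ℕ} :
    firstSome f s = none ↔ ∀ t < s, f t = none := by
  induction s with
  | zero => simp [firstSome]
  | succ s ih =>
    change (firstSome f s).casesOn (f s) some = none ↔ _
    rcases h : firstSome f s with _ | v
    · simp only [h, true_iff] at ih
      refine ⟨fun hs t ht => ?_, fun hs => hs s (by omega)⟩
      rcases Nat.lt_succ_iff_lt_or_eq.1 ht with h' | rfl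
      exacts [ih t h', hs]
    · simp only [h, reduceCtorEq, false_iff] at ih ⊢
      exact fun hs => ih fun t ht => hs t (by omega)

theorem firstSome_eq_some {f : ℕ → Option ℕ} {s v : ℕ} :
    firstSome f s = some v ↔ ∃ t < s, f t = some v ∧ ∀ t' < t, f t' = none := by
  induction s with
  | zero => simp [firstSome]
  | succ s ih =>
    change (firstSome f s).casesOn (f s) some = some v ↔ _
    rcases h : firstSome f s with _ | u
    · have hn := firstSome_eq_none.1 h
      refine ⟨fun hs => ⟨s, by omega, hs, hn⟩, ?_⟩
      rintro ⟨t, ht, hv, -⟩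
      rcases Nat.lt_succ_iff_lt_or_eq.1 ht with h' | rfl
      · simp [hn t h'] at hv
      · exact hv
    · rw [h] at ih
      refine ih.trans ⟨fun ⟨t, ht, h'⟩ => ⟨t, by omega, h'⟩, ?_⟩
      rintro ⟨t, ht, hv, hm⟩
      rcases Nat.lt_succ_iff_lt_or_eq.1 ht with h' | rfl
      · exact ⟨t, h', hv, hm⟩
      · simp [firstSome_eq_none.2 hm] at h

/-- `q` is obtained from `p` by running `φ` on longer and longer initial segments of `p` until
it gives a value. -/
def Approximates (φ : List ℕ → ℕ → Option ℕ) (p q : Baire) : Prop :=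
  ∀ n, ∃ m, φ (initSeg p m) n = some (q n) ∧ ∀ m' < m, φ (initSeg p m') n = none

/-- If every value ever given is correct, the first one is, so minimality of the search need not be
tracked. -/
theorem Approximates.of_sound {φ : List ℕ → ℕ → Option ℕ} {p q : Baire}
    (hs : ∀ n m v, φ (initSeg p m) n = some v → v = q n)
    (hc : ∀ n, ∃ m v, φ (initSeg p m) n = some v) : Approximates φ p q := by
  classical
  intro n
  have hex : ∃ m, φ (initSeg p m) n ≠ none := by
    obtain ⟨m, v, h⟩ := hc n
    exact ⟨m, by simp [h]⟩
  refine ⟨Nat.find hex, ?_, fun m' hm' => by simpa using Nat.find_min hex hm'⟩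
  obtain ⟨v, hv⟩ := Option.ne_none_iff_exists'.1 (Nat.find_spec hex)
  rw [hv, hs n _ v hv]

theorem Approximates.unique {φ : List ℕ → ℕ → Option ℕ} {p q r : Baire}
    (hq : Approximates φ p q) (hr : Approximates φ p r) : q = r := by
  funext n
  obtain ⟨m, h1, h2⟩ := hq n
  obtain ⟨m', h1', h2'⟩ := hr n
  rcases lt_trichotomy m m' with h | rfl | h
  · simp [h2' m h] at h1
  · simpa [h1] using h1'
  · simp [h2 m' h] at h1'

/-- The values that `φ` gives on initial segments of `σ`. -/
def searchValue (φ : List ℕ → ℕ → Option ℕ) (σ : List ℕ) (n : ℕ) : Option ℕ :=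
  firstSome (fun t => φ (σ.take t) n) (σ.length + 1)

theorem searchValue_mono {φ : List ℕ → ℕ → Option ℕ} {σ τ : List ℕ} (h : σ <+: τ) {n v : ℕ}
    (hv : searchValue φ σ n = some v) : searchValue φ τ n = some v := by
  obtain ⟨t, ht, hv, hm⟩ := firstSome_eq_some.1 hv
  have htake : ∀ s ≤ t, τ.take s = σ.take s := fun s hs => by
    obtain ⟨ρ, rfl⟩ := h
    exact List.take_append_of_le_length (by omega)
  refine firstSome_eq_some.2 ⟨t, by have := h.length_le; omega, ?_, fun t' ht' => ?_⟩
  · simpa [htake t le_rfl] using hv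
  · simpa [htake t' ht'.le] using hm t' ht'

theorem searchValue_initSeg {φ : List ℕ → ℕ → Option ℕ} {p q : Baire} (h : Approximates φ p q)
    (n : ℕ) : ∃ m, ∀ m' ≥ m, searchValue φ (initSeg p m') n = some (q n) := by
  obtain ⟨m, h1, h2⟩ := h n
  refine ⟨m, fun m' hm' => firstSome_eq_some.2 ⟨m, by simp; omega, ?_, fun t ht => ?_⟩⟩
  · simpa [take_initSeg p hm'] using h1
  · simpa [take_initSeg p (show t ≤ m' by omega)] using h2 t ht

/-- The word of the values of `g` before the first undefined one, of length at most `s`. -/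
def buildWord (g : ℕ → Option ℕ) (s : ℕ) : List ℕ :=
  Nat.rec [] (fun _ l => (g l.length).casesOn l fun v => l ++ [v]) s

theorem buildWord_spec (g : ℕ → Option ℕ) (s : ℕ) :
    (∀ i < (buildWord g s).length, (buildWord g s)[i]? = g i) ∧ (buildWord g s).length ≤ s ∧
      ((buildWord g s).length < s → g (buildWord g s).length = none) := by
  induction s with
  | zero => simp [buildWord]
  | succ s ih =>
    have hstep : buildWord g (s + 1) =
      (g (buildWord g s).length).casesOn (buildWord g s) fun v => buildWord g s ++ [v] := rfl
    obtain ⟨h1, h2, h3⟩ := ih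
    rcases hg : g (buildWord g s).length with _ | v
    · rw [hg] at hstep
      simp only at hstep
      rw [hstep]
      exact ⟨h1, by omega, fun _ => hg⟩
    · rw [hg] at hstep
      simp only at hstep
      have hl : (buildWord g s).length = s := by
        by_contra hne
        simp [h3 (by omega)] at hg
      rw [hstep]
      refine ⟨fun i hi => ?_, by simp; omega, fun h => by simp at h; omega⟩
      rcases lt_or_ge i (buildWord g s).length with hi' | hi'
      · rw [List.getElem?_append_left hi', h1 i hi']
      · have : i = (buildWord g s).length := by simp at hi; omega
        subst this
        simp [hg]

theorem buildWord_mono {g g' : ℕ → Option ℕ} (h : ∀ n v, g n = some v → g' n = some v) {s s' : ℕ}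
    (hs : s ≤ s') : buildWord g s <+: buildWord g' s' := by
  obtain ⟨h1, h2, -⟩ := buildWord_spec g s
  obtain ⟨h1', -, h3'⟩ := buildWord_spec g' s'
  have hval : ∀ i (hi : i < (buildWord g s).length), g' i = some (buildWord g s)[i] :=
    fun i hi => h i _ (by rw [← h1 i hi, List.getElem?_eq_getElem hi])
  have hlen : (buildWord g s).length ≤ (buildWord g' s').length := by
    by_contra hlt
    have := hval (buildWord g' s').length (by omega)
    rw [h3' (by omega)] at this
    simp at this
  rw [List.prefix_iff_getElem?]
  intro i hi
  rw [h1' i (by omega), hval i hi]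

theorem initSeg_prefix_buildWord {g : ℕ → Option ℕ} {q : Baire} {n s : ℕ} (hs : n ≤ s)
    (h : ∀ i < n, g i = some (q i)) : initSeg q n <+: buildWord g s := by
  obtain ⟨h1, -, h3⟩ := buildWord_spec g s
  have hlen : n ≤ (buildWord g s).length := by
    by_contra hlt
    have := h (buildWord g s).length (by omega)
    rw [h3 (by omega)] at this
    simp at this
  rw [initSeg_prefix_iff]
  intro i hi
  rw [h1 i (by omega), h i hi]

theorem computable_searchValue {φ : List ℕ → ℕ → Option ℕ} (hφ : Computable₂ φ) :
    Computable₂ (searchValue φ) := by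
  have htake : Computable₂ (List.take : ℕ → List ℕ → List ℕ) := Primrec.list_take.to_comp
  refine Computable.nat_rec (σ := Option ℕ) (f := fun a : List ℕ × ℕ => a.1.length + 1)
    (g := fun _ => none)
    (h := fun a b => b.2.casesOn (φ (a.1.take b.1) a.2) some) ?_ (Computable.const _) ?_
  · exact Computable.succ.comp (Computable.list_length.comp Computable.fst)
  · refine Computable.option_casesOn (Computable.snd.comp Computable.snd) ?_ ?_
    · exact hφ.comp (htake.comp (Computable.fst.comp Computable.snd)
        (Computable.fst.comp Computable.fst)) (Computable.snd.comp Computable.fst)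
    · exact (Computable.option_some.comp Computable.snd).to₂

theorem computable_buildWord {g : List ℕ → ℕ → Option ℕ} (hg : Computable₂ g) :
    Computable fun σ => buildWord (g σ) σ.length := by
  refine Computable.nat_rec (σ := List ℕ) (f := fun a : List ℕ => a.length) (g := fun _ => [])
    (h := fun a b => (g a b.2.length).casesOn b.2 fun v => b.2 ++ [v]) Computable.list_length
    (Computable.const _) ?_
  refine Computable.option_casesOn ?_ (Computable.snd.comp Computable.snd) ?_
  · exact hg.comp Computable.fst (Computable.list_length.comp
      (Computable.snd.comp Computable.snd))
  · exact Computable.list_concat.comp (Computable.snd.comp (Computable.snd.comp Computable.fst))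
      Computable.snd

/-- `φ` need not be monotone. Keeping the first value found on prefixes of `σ` makes each entry
permanent, and listing entries up to the first gap gives a function monotone on all words. -/
theorem ComputableFunctional.of_approximates {F : Baire →. Baire} {φ : List ℕ → ℕ → Option ℕ}
    (hφ : Computable₂ φ) (h : ∀ p q, q ∈ F p → Approximates φ p q) : ComputableFunctional F := by
  refine ⟨fun σ => buildWord (searchValue φ σ) σ.length,
    computable_buildWord (computable_searchValue hφ),
    fun σ τ hστ => buildWord_mono (fun n v => searchValue_mono hστ) hστ.length_le,
    fun p q hq n => ?_⟩
  have hev : ∀ᶠ m in atTop, ∀ i < n, searchValue φ (initSeg p m) i = some (q i) := by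
    have : ∀ᶠ m in atTop, ∀ i ∈ Finset.range n, searchValue φ (initSeg p m) i = some (q i) := by
      rw [Filter.eventually_all_finset]
      exact fun i _ => eventually_atTop.2 (searchValue_initSeg (h p q hq) i)
    simpa using this
  obtain ⟨m, hm, hn⟩ := (hev.and (eventually_ge_atTop n)).exists
  exact ⟨m, initSeg_prefix_buildWord (by simpa using hn) hm⟩

/-- By monotonicity all outputs along `p` are comparable, so an entry present in one of them agrees
with the true value. -/
theorem ComputableFunctional.exists_approximates {F : Baire →. Baire}
    (hF : ComputableFunctional F) :
    ∃ φ, Computable₂ φ ∧ ∀ p q, q ∈ F p → Approximates φ p q := by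
  obtain ⟨h, hh, hmono, hF⟩ := hF
  refine ⟨fun σ n => (h σ)[n]?, Computable.list_getElem?.comp (hh.comp Computable.fst)
    Computable.snd, fun p q hq => Approximates.of_sound (fun n m v hv => ?_) fun n => ?_⟩
  · obtain ⟨m', hm'⟩ := hF p q hq (n + 1)
    have h1 := List.prefix_iff_getElem?.1
      (hm'.trans (hmono _ _ (initSeg_prefix p (le_max_right m m')))) n (by simp)
    obtain ⟨ρ, hρ⟩ := hmono _ _ (initSeg_prefix p (le_max_left m m'))
    have hn : n < (h (initSeg p m)).length := by
      by_contra hn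
      simp [List.getElem?_eq_none (not_lt.1 hn)] at hv
    rw [← hρ, List.getElem?_append_left hn, hv] at h1
    simpa [initSeg] using h1
  · obtain ⟨m', hm'⟩ := hF p q hq (n + 1)
    exact ⟨m', _, initSeg_prefix_iff.1 hm' n (by omega)⟩

/-- The partial functional given by a search on initial segments. -/
noncomputable def searchFunctional (φ : List ℕ → ℕ → Option ℕ) : Baire →. Baire :=
  fun p => ⟨∃ q, Approximates φ p q, fun h => h.choose⟩

theorem mem_searchFunctional {φ : List ℕ → ℕ → Option ℕ} {p q : Baire} :
    q ∈ searchFunctional φ p ↔ Approximates φ p q :=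
  ⟨fun ⟨h, e⟩ => e ▸ h.choose_spec, fun h => ⟨⟨q, h⟩, (Exists.choose_spec ⟨q, h⟩).unique h⟩⟩

theorem computableFunctional_searchFunctional {φ : List ℕ → ℕ → Option ℕ} (hφ : Computable₂ φ) :
    ComputableFunctional (searchFunctional φ) :=
  .of_approximates hφ fun _ _ => mem_searchFunctional.1

/-- A total functional whose value at `n` is computed from an initial segment of length `b n`. -/
theorem computableFunctional_of_use {Φ : Baire → Baire} (b : ℕ → ℕ) (g : List ℕ → ℕ → ℕ)
    (hb : Primrec b) (hg : Computable₂ g) (h : ∀ p n, Φ p n = g (initSeg p (b n)) n) :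
    ComputableFunctional fun p => Part.some (Φ p) := by
  refine .of_approximates (φ := fun σ n => bif decide (b n ≤ σ.length) then
    some (g (σ.take (b n)) n) else none) ?_ ?_
  · have h1 : Computable fun a : List ℕ × ℕ => decide (b a.2 ≤ a.1.length) :=
      (PrimrecPred.decide (PrimrecRel.comp Primrec.nat_le (hb.comp Primrec.snd)
        (Primrec.list_length.comp Primrec.fst))).to_comp
    have htake : Computable₂ (List.take : ℕ → List ℕ → List ℕ) := Primrec.list_take.to_comp
    exact Computable.cond h1 (Computable.option_some.comp
      (hg.comp (htake.comp (hb.to_comp.comp Computable.snd) Computable.fst) Computable.snd))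
      (Computable.const _)
  · rintro p q hq
    rw [Part.mem_some_iff.1 hq]
    refine .of_sound (fun n m v hv => ?_) fun n => ?_
    · by_cases hm : b n ≤ m
      · simp only [length_initSeg, hm, decide_true, cond_true, take_initSeg p hm] at hv
        rw [h, Option.some.inj hv]
      · simp [hm] at hv
    · exact ⟨b n, g (initSeg p (b n)) n, by simp [take_initSeg]⟩

/-- A total functional that permutes, repeats or drops entries. -/
theorem computableFunctional_reindex {b : ℕ → ℕ} (hb : Primrec b) :
    ComputableFunctional fun p => Part.some fun n => p (b n) := by
  refine computableFunctional_of_use (Φ := fun p n => p (b n)) (fun n => b n + 1)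
    (fun σ n => σ.getD (b n) 0) (Primrec.succ.comp hb)
    ((Primrec.list_getD 0).comp Primrec.fst (hb.comp Primrec.snd)).to_comp fun p n => ?_
  rw [getD_initSeg p (by omega)]

theorem ComputableFunctional.comp {F G : Baire →. Baire} (hF : ComputableFunctional F)
    (hG : ComputableFunctional G) : ComputableFunctional fun p => (F p).bind G := by
  obtain ⟨f, hf, fmono, hF⟩ := hF
  obtain ⟨g, hg, gmono, hG⟩ := hG
  refine ⟨fun σ => g (f σ), hg.comp hf, fun σ τ h => gmono _ _ (fmono _ _ h), fun p r hr n => ?_⟩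
  obtain ⟨q, hq, hr⟩ := Part.mem_bind_iff.1 hr
  obtain ⟨m, hm⟩ := hG q r hr n
  obtain ⟨m', hm'⟩ := hF p q hq m
  exact ⟨m', hm.trans (gmono _ _ hm')⟩

/-! ### Pairing and Weihrauch reducibility -/

@[simp] theorem pair_even (p q : Baire) (n : ℕ) : pair p q (2 * n) = p n := by simp [pair]

@[simp] theorem pair_odd (p q : Baire) (n : ℕ) : pair p q (2 * n + 1) = q n := by
  simp [pair, Nat.add_mod]; congr 1; omega

theorem pair_inj {p q p' q' : Baire} : pair p q = pair p' q' ↔ p = p' ∧ q = q' := by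
  refine ⟨fun h => ⟨funext fun n => ?_, funext fun n => ?_⟩, fun ⟨h1, h2⟩ => h1 ▸ h2 ▸ rfl⟩
  · simpa using congrFun h (2 * n)
  · simpa using congrFun h (2 * n + 1)

theorem primrec_double : Primrec fun n : ℕ => 2 * n :=
  Primrec.nat_mul.comp (Primrec.const 2) Primrec.id

theorem primrec_double_add_one : Primrec fun n : ℕ => 2 * n + 1 :=
  Primrec.succ.comp primrec_double

theorem ComputableFunctional.pair {F G : Baire →. Baire} (hF : ComputableFunctional F)
    (hG : ComputableFunctional G) :
    ComputableFunctional fun p => (F p).bind fun q => (G p).map fun r => pair q r := by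
  obtain ⟨φ, hφ, hF⟩ := hF.exists_approximates
  obtain ⟨ψ, hψ, hG⟩ := hG.exists_approximates
  refine .of_approximates (φ := fun σ n => bif n % 2 == 0 then φ σ (n / 2) else ψ σ (n / 2))
    ?_ fun p r hr => ?_
  · have hdiv : Computable fun a : List ℕ × ℕ => a.2 / 2 :=
      (Primrec.nat_div.comp Primrec.snd (Primrec.const 2)).to_comp
    have hmod : Computable fun a : List ℕ × ℕ => a.2 % 2 == 0 :=
      (Primrec.beq.comp (Primrec.nat_mod.comp Primrec.snd (Primrec.const 2))
        (Primrec.const 0)).to_comp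
    exact Computable.cond hmod (hφ.comp Computable.fst hdiv) (hψ.comp Computable.fst hdiv)
  · obtain ⟨q, hq, hr⟩ := Part.mem_bind_iff.1 hr
    obtain ⟨s, hs, rfl⟩ := (Part.mem_map_iff _).1 hr
    intro n
    by_cases hn : n % 2 = 0
    · simpa [Weihrauch.pair, hn] using hF p q hq (n / 2)
    · have : (n % 2 == 0) = false := by simpa using hn
      simpa only [Weihrauch.pair, hn, if_false, this, cond_false] using hG p s hs (n / 2)

theorem computableFunctional_left :
    ComputableFunctional fun p => Part.some fun n => p (2 * n) :=
  computableFunctional_reindex primrec_double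

theorem computableFunctional_right :
    ComputableFunctional fun p => Part.some fun n => p (2 * n + 1) :=
  computableFunctional_reindex primrec_double_add_one

theorem computableFunctional_id : ComputableFunctional fun p => Part.some p :=
  computableFunctional_reindex Primrec.id

/-- `H` and `K` translate instances of `g` into instances of `f` and solutions back. -/
theorem reducible_iff {g f : Problem} :
    g ≤W f ↔ ∃ H K : Baire →. Baire, ComputableFunctional H ∧ ComputableFunctional K ∧
      ∀ p ∈ g.dom, ∃ y ∈ H p, y ∈ f.dom ∧ ∀ z ∈ f y, ∃ u ∈ K (pair z p), u ∈ g p := by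
  constructor
  · rintro ⟨H, K, hH, hK, h⟩
    refine ⟨H, K, hH, hK, fun p hp => ?_⟩
    have key : ∀ F, Realizes F f →
        ∃ u, u ∈ g p ∧ ∃ y ∈ H p, ∃ z ∈ F y, u ∈ K (pair z p) := fun F hF => by
      obtain ⟨u, hu, hg⟩ := h F hF p hp
      obtain ⟨y, hy, hu⟩ := Part.mem_bind_iff.1 hu
      obtain ⟨z, hz, hu⟩ := Part.mem_bind_iff.1 hu
      exact ⟨u, hg, y, hy, z, hz, hu⟩
    -- This realizer is undefined outside `f.dom`, so definedness of the composite forces `H p` into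
    -- the domain.
    let F : Baire →. Baire := fun y => ⟨y ∈ f.dom, fun h => h.choose⟩
    have hF : Realizes F f := fun y hy => ⟨hy.choose, ⟨hy, rfl⟩, hy.choose_spec⟩
    obtain ⟨-, -, y, hy, -, ⟨hdom, -⟩, -⟩ := key F hF
    refine ⟨y, hy, hdom, fun z hz => ?_⟩
    classical
    -- Changing the realizer at `y` alone makes it return the prescribed solution `z`.
    let F' : Baire →. Baire := fun y' => if y' = y then Part.some z else F y'
    have hF' : Realizes F' f := fun y' hy' => by
      by_cases e : y' = y
      · subst e
        exact ⟨z, by simp [F'], hz⟩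
      · simpa [F', e] using hF y' hy'
    obtain ⟨u, hu, y', hy', z', hz', hK'⟩ := key F' hF'
    obtain rfl := Part.mem_unique hy' hy
    have : z' = z := by simpa [F'] using hz'
    exact ⟨u, this ▸ hK', hu⟩
  · rintro ⟨H, K, hH, hK, h⟩
    refine ⟨H, K, hH, hK, fun F hF p hp => ?_⟩
    obtain ⟨y, hy, hdom, hz⟩ := h p hp
    obtain ⟨z, hzF, hzf⟩ := hF y hdom
    obtain ⟨u, hu, hug⟩ := hz z hzf
    exact ⟨u, Part.mem_bind_iff.2 ⟨y, hy, Part.mem_bind_iff.2 ⟨z, hzF, hu⟩⟩, hug⟩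

theorem mem_left (p q : Baire) : p ∈ Part.some fun n => pair p q (2 * n) :=
  Part.mem_some_iff.2 (funext fun n => (pair_even p q n).symm)

theorem mem_right (p q : Baire) : q ∈ Part.some fun n => pair p q (2 * n + 1) :=
  Part.mem_some_iff.2 (funext fun n => (pair_odd p q n).symm)

theorem mem_comp {o : Part Baire} {G : Baire →. Baire} {q r : Baire} (hq : q ∈ o) (hr : r ∈ G q) :
    r ∈ o.bind G :=
  Part.mem_bind hq hr

theorem mem_pair {o o' : Part Baire} {q r : Baire} (hq : q ∈ o) (hr : r ∈ o') :
    pair q r ∈ o.bind fun q => o'.map fun r => pair q r :=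
  Part.mem_bind hq (Part.mem_map _ hr)

theorem Reducible.of_subset {g f : Problem} (hdom : ∀ p ∈ g.dom, p ∈ f.dom)
    (h : ∀ p ∈ g.dom, f p ⊆ g p) : g ≤W f :=
  reducible_iff.2 ⟨_, _, computableFunctional_id, computableFunctional_left, fun p hp =>
    ⟨p, Part.mem_some p, hdom p hp, fun z hz =>
      ⟨z, mem_left z p, h p hp hz⟩⟩⟩

theorem Reducible.refl (f : Problem) : f ≤W f :=
  .of_subset (fun _ h => h) fun _ _ => subset_rfl

theorem Reducible.trans {f g h : Problem} (hfg : f ≤W g) (hgh : g ≤W h) : f ≤W h := by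
  obtain ⟨H, K, hH, hK, hfg⟩ := reducible_iff.1 hfg
  obtain ⟨H', K', hH', hK', hgh⟩ := reducible_iff.1 hgh
  -- `z, x ↦ K ⟨K' ⟨z, H x⟩, x⟩`
  refine reducible_iff.2 ⟨_, _, hH.comp hH', (((computableFunctional_left.pair
    (computableFunctional_right.comp hH)).comp hK').pair computableFunctional_right).comp hK,
    fun p hp => ?_⟩
  obtain ⟨y, hy, hyg, hsol⟩ := hfg p hp
  obtain ⟨y', hy', hyh, hsol'⟩ := hgh y hyg
  refine ⟨y', mem_comp hy hy', hyh, fun z hz => ?_⟩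
  obtain ⟨u, hu, hug⟩ := hsol' z hz
  obtain ⟨v, hv, hvf⟩ := hsol u hug
  exact ⟨v, mem_comp (mem_pair (mem_comp (mem_pair (mem_left z p)
    (mem_comp (mem_right z p) hy)) hu) (mem_right z p)) hv, hvf⟩

/-! ### Reductions uniform in the number of colours -/

/-- The sequence with first entry `k` and tail `p`. -/
def cons (k : ℕ) (p : Baire) : Baire := fun n => Nat.casesOn n k p

@[simp] theorem cons_zero (k : ℕ) (p : Baire) : cons k p 0 = k := rfl

@[simp] theorem cons_succ (k : ℕ) (p : Baire) (n : ℕ) : cons k p (n + 1) = p n := rfl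

theorem cons_head_tail (p : Baire) : cons (p 0) (tail p) = p := by
  funext n; cases n <;> rfl

theorem computableFunctional_tail : ComputableFunctional fun p => Part.some (tail p) :=
  computableFunctional_reindex Primrec.succ

theorem computableFunctional_cons (k : ℕ) :
    ComputableFunctional fun p => Part.some (cons k p) := by
  refine computableFunctional_of_use (fun n => n)
    (fun σ n => Nat.casesOn n k fun m => σ.getD m 0) Primrec.id ?_ fun p n => ?_
  · exact (Primrec.nat_casesOn Primrec.snd (Primrec.const k)
      ((Primrec.list_getD 0).comp (Primrec.fst.comp Primrec.fst) Primrec.snd).to₂).to_comp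
  · cases n with
    | zero => rfl
    | succ n => exact (getD_initSeg p (Nat.lt_succ_self n) 0).symm

/-- Reducibility of `g k` to `f k`, uniformly in `k`, where `k` is given along with the instance
and does not change. -/
def FiberReducible (g f : ℕ → Problem) : Prop :=
  ∃ H K : Baire →. Baire, ComputableFunctional H ∧ ComputableFunctional K ∧
    ∀ k, ∀ p ∈ (g k).dom, ∃ y ∈ H (cons k p), y ∈ (f k).dom ∧
      ∀ z ∈ f k y, ∃ u ∈ K (pair z (cons k p)), u ∈ g k p

theorem FiberReducible.reducible {g f : ℕ → Problem} (h : FiberReducible g f) (k : ℕ) :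
    g k ≤W f k := by
  obtain ⟨H, K, hH, hK, h⟩ := h
  refine reducible_iff.2 ⟨_, _, (computableFunctional_cons k).comp hH,
    (computableFunctional_left.pair
      (computableFunctional_right.comp (computableFunctional_cons k))).comp hK, fun p hp => ?_⟩
  obtain ⟨y, hy, hyf, hz⟩ := h k p hp
  refine ⟨y, mem_comp (Part.mem_some _) hy, hyf, fun z hzf => ?_⟩
  obtain ⟨u, hu, hug⟩ := hz z hzf
  exact ⟨u, mem_comp (mem_pair (mem_left z p)
    (mem_comp (mem_right z p) (Part.mem_some _))) hu, hug⟩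

theorem primrec_consIndex (c : ℕ) :
    Primrec fun n : ℕ => (Nat.casesOn n c fun m => 2 * m + 1 : ℕ) :=
  Primrec.nat_casesOn Primrec.id (Primrec.const c) (primrec_double_add_one.comp Primrec.snd)

theorem FiberReducible.disjointUnion {g f : ℕ → Problem} (h : FiberReducible g f) {S T : Set ℕ}
    (hST : ∀ k ∈ S, (g k).dom.Nonempty → k ∈ T) : disjointUnion S g ≤W disjointUnion T f := by
  obtain ⟨H, K, hH, hK, h⟩ := h
  -- The index `p 0` is copied to the front: it is entry `0` of `⟨p, y⟩` and entry `2` of `⟨⟨z, p⟩,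
  -- u⟩`. The rest of the output is the odd part.
  refine reducible_iff.2 ⟨_, _,
    (computableFunctional_id.pair hH).comp (computableFunctional_reindex (primrec_consIndex 0)),
    (computableFunctional_id.pair (((computableFunctional_left.comp computableFunctional_tail).pair
      computableFunctional_right).comp hK)).comp
      (computableFunctional_reindex (primrec_consIndex 2)), fun p hp => ?_⟩
  obtain ⟨q, hS, -, hq⟩ := hp
  obtain ⟨y, hy, hyf, hz⟩ := h (p 0) (tail p) ⟨_, hq⟩
  rw [cons_head_tail] at hy hz
  refine ⟨cons (p 0) y, ?_, ?_, fun z hzf => ?_⟩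
  · refine mem_comp (mem_pair (Part.mem_some p) hy) (Part.mem_some_iff.2 (funext fun n => ?_))
    cases n with
    | zero => simp [pair]
    | succ n => exact (pair_odd p y n).symm
  · obtain ⟨r, hr⟩ := hyf
    exact ⟨cons (p 0) r, hST _ hS ⟨_, _, hq⟩, rfl, hr⟩
  · obtain ⟨-, -, hzf⟩ := hzf
    obtain ⟨u, hu, hug⟩ := hz (tail z) hzf
    refine ⟨cons (p 0) u, mem_comp (mem_pair (Part.mem_some _) (mem_comp (mem_pair (mem_comp
      (mem_left z p) (Part.mem_some _)) (mem_right z p)) hu))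
      (Part.mem_some_iff.2 (funext fun n => ?_)), hS, rfl, hug⟩
    cases n with
    | zero => simp [pair]
    | succ n => exact (pair_odd _ u n).symm

/-! ### Evaluating and producing codes: the finitary part is greatest -/

theorem primrecPred_forall_lt {α : Type} [Primcodable α] {R : ℕ → α → Prop} {b : α → ℕ}
    (hR : PrimrecRel R) (hb : Primrec b) : PrimrecPred fun a => ∀ m < b a, R m a :=
  (hR.forall_mem_list.comp (Primrec.list_range.comp hb) Primrec.id).of_eq (by simp)

theorem primrecPred_exists_lt {α : Type} [Primcodable α] {R : ℕ → α → Prop} {b : α → ℕ}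
    (hR : PrimrecRel R) (hb : Primrec b) : PrimrecPred fun a => ∃ m < b a, R m a :=
  (hR.exists_mem_list.comp (Primrec.list_range.comp hb) Primrec.id).of_eq (by simp)

theorem HasValue.unique {w q : Baire} {i j : ℕ} (hi : HasValue w q i) (hj : HasValue w q j) :
    i = j := by
  obtain ⟨n, h1, h2⟩ := hi
  obtain ⟨m, h1', h2'⟩ := hj
  rcases lt_trichotomy n m with h | rfl | h
  · rw [h2' n h] at h1; omega
  · omega
  · rw [h2 m h] at h1'; omega

/-- The code of the initial segment of length `m` of `q`, read off from a word
that approximates `⟨q, ⟨w, p⟩⟩`. -/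
def segCode (σ : List ℕ) (m : ℕ) : ℕ :=
  Encodable.encode ((List.range m).map fun l => σ.getD (2 * l) 0)

theorem segCode_initSeg (q r : Baire) {m s : ℕ} (h : 2 * m ≤ s) :
    segCode (initSeg (pair q r) s) m = Encodable.encode (initSeg q m) := by
  unfold segCode
  congr 1
  refine List.map_congr_left fun l hl => ?_
  have := List.mem_range.1 hl
  rw [getD_initSeg _ (by omega), pair_even]

theorem primrec_segCode : Primrec₂ segCode := by
  refine Primrec.encode.comp (Primrec.list_map (Primrec.list_range.comp Primrec.snd) ?_)
  exact ((Primrec.list_getD 0).comp (Primrec.fst.comp Primrec.fst)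
    (primrec_double.comp Primrec.snd)).to₂

/-- In the word `σ`, an approximation of `⟨q, ⟨w, p⟩⟩`, the first nonzero value of `w` on initial
segments of `q` is at length `m`. -/
def FirstAt (σ : List ℕ) (m : ℕ) : Prop :=
  2 * m ≤ σ.length ∧ σ.getD (2 * (2 * segCode σ m) + 1) 0 ≠ 0 ∧
    ∀ m' < m, σ[2 * (2 * segCode σ m') + 1]? = some 0

theorem primrecRel_firstAt : PrimrecRel FirstAt := by
  have hidx : Primrec₂ fun (σ : List ℕ) m => 2 * (2 * segCode σ m) + 1 :=
    primrec_double_add_one.comp (primrec_double.comp primrec_segCode)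
  have h1 : PrimrecPred fun a : List ℕ × ℕ => 2 * a.2 ≤ a.1.length :=
    PrimrecRel.comp Primrec.nat_le (primrec_double.comp Primrec.snd)
      (Primrec.list_length.comp Primrec.fst)
  have h2 : PrimrecPred fun a : List ℕ × ℕ => ¬ a.1.getD (2 * (2 * segCode a.1 a.2) + 1) 0 = 0 :=
    (PrimrecRel.comp Primrec.eq ((Primrec.list_getD 0).comp Primrec.fst hidx)
      (Primrec.const 0)).not
  have h3 : PrimrecRel fun (m : ℕ) (a : List ℕ × ℕ) =>
      a.1[2 * (2 * segCode a.1 m) + 1]? = some 0 :=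
    PrimrecRel.comp Primrec.eq (Primrec.list_getElem?.comp (Primrec.fst.comp Primrec.snd)
      (hidx.comp (Primrec.fst.comp Primrec.snd) Primrec.fst)) (Primrec.const (some 0))
  exact h1.and (h2.and (primrecPred_forall_lt h3 Primrec.snd))

/-- Both tests in `FirstAt` can succeed only on entries really present: a nonzero entry is not the
default `0`, and `some 0` is not out of range. -/
theorem FirstAt.hasValue {q w p : Baire} {s m : ℕ}
    (h : FirstAt (initSeg (pair q (pair w p)) s) m) :
    HasValue w q ((initSeg (pair q (pair w p)) s).getD
      (2 * (2 * segCode (initSeg (pair q (pair w p)) s) m) + 1) 0 - 1) := by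
  obtain ⟨h1, h2, h3⟩ := h
  rw [length_initSeg] at h1
  have hval : ∀ i, (initSeg (pair q (pair w p)) s).getD i 0 ≠ 0 ∨
      (initSeg (pair q (pair w p)) s)[i]? = some 0 →
      (initSeg (pair q (pair w p)) s).getD i 0 = pair q (pair w p) i := fun i hi => by
    by_cases hs : i < s
    · exact getD_initSeg _ hs 0
    · rw [List.getD_eq_getElem?_getD, List.getElem?_eq_none (by simpa using hs)] at hi
      simp at hi
  refine ⟨m, ?_, fun m' hm' => ?_⟩
  · have := hval _ (.inl h2)
    rw [segCode_initSeg _ _ h1, pair_odd, pair_even] at this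
    rw [segCode_initSeg _ _ h1] at h2 ⊢
    omega
  · have h3 := h3 m' hm'
    have := hval _ (.inr h3)
    rw [List.getD_eq_getElem?_getD, h3, segCode_initSeg _ _ (by omega), pair_odd, pair_even] at this
    simpa using this.symm

/-- Evaluation of the functional coded by `w` at `q`, on approximations of `⟨q, ⟨w, p⟩⟩`. -/
noncomputable def evalSearch (σ : List ℕ) (_ : ℕ) : Option ℕ :=
  open Classical in
  if FirstAt σ σ.length.unpair.1 then
    some (σ.getD (2 * (2 * segCode σ σ.length.unpair.1) + 1) 0 - 1) else none

theorem primrec_evalSearch : Primrec₂ evalSearch := by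
  have hm : Primrec fun a : List ℕ × ℕ => a.1.length.unpair.1 :=
    Primrec.fst.comp (Primrec.unpair.comp (Primrec.list_length.comp Primrec.fst))
  have hidx : Primrec fun a : List ℕ × ℕ => 2 * (2 * segCode a.1 a.1.length.unpair.1) + 1 :=
    primrec_double_add_one.comp (primrec_double.comp (primrec_segCode.comp Primrec.fst hm))
  classical
  exact (Primrec.ite (primrecRel_firstAt.comp Primrec.fst hm)
    (Primrec.option_some.comp (Primrec.pred.comp
      ((Primrec.list_getD 0).comp Primrec.fst hidx))) (Primrec.const none)).of_eq fun a => by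
        simp only [evalSearch, Nat.pred_eq_sub_one]

theorem evalSearch_approximates {q w p : Baire} {i : ℕ} (h : HasValue w q i) :
    Approximates evalSearch (pair q (pair w p)) fun _ => i := by
  refine .of_sound (fun _ s v hv => ?_) fun _ => ?_
  · unfold evalSearch at hv
    split_ifs at hv with hf
    rw [← Option.some.inj hv]
    exact hf.hasValue.unique h
  · obtain ⟨m, h1, h2⟩ := h
    -- At length `Nat.pair m t` the search tries the candidate `m`; since this length is at least
    -- `t`, all entries of `w` it consults are present.
    obtain ⟨t, ht, hm⟩ : ∃ t, (∀ m' ∈ Finset.range (m + 1),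
        2 * (2 * Encodable.encode (initSeg q m')) + 1 < t) ∧ 2 * m ≤ t :=
      (((Filter.eventually_all_finset _).2 fun _ _ => eventually_gt_atTop _).and
        (eventually_ge_atTop _)).exists
    have hs : t ≤ Nat.pair m t := Nat.right_le_pair m t
    refine ⟨Nat.pair m t, _, if_pos ?_⟩
    rw [length_initSeg, Nat.unpair_pair]
    refine ⟨by simp; omega, ?_, fun m' hm' => ?_⟩
    · rw [segCode_initSeg _ _ (by omega),
        getD_initSeg _ ((ht m (by simp)).trans_le hs), pair_odd, pair_even, h1]
      omega
    · rw [segCode_initSeg _ _ (by omega),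
        getElem?_initSeg _ ((ht m' (by simp; omega)).trans_le hs), pair_odd, pair_even, h2 m' hm']

theorem finPart_reducible (k : ℕ) (f : Problem) : (finPart k f).toProblem ≤W f := by
  refine reducible_iff.2 ⟨_, _, computableFunctional_right,
    computableFunctional_searchFunctional primrec_evalSearch.to_comp, ?_⟩
  rintro _ ⟨-, j, ⟨w, p, rfl, hw, q, hq, -⟩, -⟩
  refine ⟨p, mem_right w p, ⟨q, hq⟩, fun z hz => ?_⟩
  obtain ⟨i, hi, hv⟩ := hw z hz
  exact ⟨_, mem_searchFunctional.2 (evalSearch_approximates hv),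
    ⟨i, hi⟩, ⟨w, p, rfl, hw, z, hz, hv⟩, rfl⟩

/-- The word alternating between `ρ` and `σ`, with `ρ` on even places, of length `2 * ρ.length`. -/
def interleave (σ ρ : List ℕ) : List ℕ :=
  (List.range (2 * ρ.length)).map fun n =>
    if n % 2 = 0 then ρ.getD (n / 2) 0 else σ.getD (n / 2) 0

theorem primrec_interleave : Primrec₂ interleave := by
  refine Primrec.list_map (Primrec.list_range.comp (primrec_double.comp
    (Primrec.list_length.comp Primrec.snd))) ?_
  have hdiv : Primrec fun a : (List ℕ × List ℕ) × ℕ => a.2 / 2 :=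
    Primrec.nat_div.comp Primrec.snd (Primrec.const 2)
  refine Primrec.ite (PrimrecRel.comp Primrec.eq (Primrec.nat_mod.comp Primrec.snd
    (Primrec.const 2)) (Primrec.const 0)) ?_ ?_
  · exact (Primrec.list_getD 0).comp (Primrec.snd.comp Primrec.fst) hdiv
  · exact (Primrec.list_getD 0).comp (Primrec.fst.comp Primrec.fst) hdiv

theorem interleave_initSeg (x q : Baire) (n : ℕ) :
    interleave (initSeg x n) (initSeg q n) = initSeg (pair q x) (2 * n) := by
  unfold interleave
  rw [length_initSeg]
  refine List.map_congr_left fun l hl => ?_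
  have := List.mem_range.1 hl
  rw [getD_initSeg _ (by omega), getD_initSeg _ (by omega), pair]

/-- The code of the functional `q ↦ K ⟨q, x⟩ 0` is computable from `x`. -/
theorem exists_code {H K : Baire →. Baire} (hH : ComputableFunctional H)
    (hK : ComputableFunctional K) : ∃ H' : Baire →. Baire, ComputableFunctional H' ∧
      ∀ x, ∀ y ∈ H x, ∃ w, pair w y ∈ H' x ∧ ∀ q, ∀ u ∈ K (pair q x), HasValue w q (u 0) := by
  obtain ⟨h, hh, hmono, hK⟩ := hK
  let word : ℕ → List ℕ := fun c => (Encodable.decode c).getD []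
  have hword : Primrec word := Primrec.option_getD.comp Primrec.decode (Primrec.const [])
  -- The code is `0` while `K` has produced no output, and `v + 1` once its first entry is `v`. A
  -- word of length `n` needs only `n` entries of `x`.
  let g : List ℕ → ℕ → ℕ := fun σ c =>
    (h (interleave σ (word c)))[0]?.casesOn 0 Nat.succ
  have hg : Computable₂ g := by
    refine Computable.option_casesOn (Computable.list_getElem?.comp (hh.comp
      (primrec_interleave.to_comp.comp Computable.fst (hword.to_comp.comp Computable.snd)))
      (Computable.const 0)) (Computable.const 0) ?_
    exact (Computable.succ.comp Computable.snd).to₂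
  let w : Baire → Baire := fun x c => g (initSeg x (word c).length) c
  have hw : ComputableFunctional fun x => Part.some (w x) :=
    computableFunctional_of_use (fun c => (word c).length) g (Primrec.list_length.comp hword) hg
      fun _ _ => rfl
  refine ⟨_, hw.pair hH, fun x y hy => ⟨w x, mem_pair (Part.mem_some _) hy, fun q u hu => ?_⟩⟩
  have hwq : ∀ m, w x (Encodable.encode (initSeg q m)) =
      (h (initSeg (pair q x) (2 * m)))[0]?.casesOn 0 Nat.succ := fun m => by
    simp only [w, g, word, Encodable.encodek, Option.getD_some, length_initSeg,
      interleave_initSeg]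
  obtain ⟨M, hM⟩ := hK _ u hu 1
  -- Monotonicity of `h` makes the first output entry independent of the stage at which it appears.
  have hval : ∀ m v, (h (initSeg (pair q x) m))[0]? = some v → v = u 0 := fun m v hv => by
    have h1 := initSeg_prefix_iff.1 (hM.trans (hmono _ _ (initSeg_prefix _ (le_max_left M m)))) 0
      one_pos
    obtain ⟨ρ, hρ⟩ := hmono _ _ (initSeg_prefix (pair q x) (le_max_right M m))
    rw [← hρ, List.getElem?_append_left (by
      by_contra hn
      simp [List.getElem?_eq_none (not_lt.1 hn)] at hv), hv] at h1
    exact Option.some.inj h1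
  have hex : ∃ m, (h (initSeg (pair q x) (2 * m)))[0]? ≠ none := ⟨M, by
    rw [initSeg_prefix_iff.1 (hM.trans (hmono _ _ (initSeg_prefix _ (by omega)))) 0 one_pos]
    simp⟩
  classical
  refine ⟨Nat.find hex, ?_, fun m hm => ?_⟩
  · obtain ⟨v, hv⟩ := Option.ne_none_iff_exists'.1 (Nat.find_spec hex)
    rw [hwq, hv, hval _ v hv]
  · rw [hwq, not_not.1 (Nat.find_min hex hm)]

/-- Values are unique and pairing is injective, so nothing outside `s` can be a solution. In use,
`s` is the solution set of the problem being reduced. -/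
theorem finPart_solution {k : ℕ} {f : Problem} {s : Set (Fin k)} {w y : Baire} (hy : y ∈ f.dom)
    (h : ∀ q ∈ f y, ∃ j ∈ s, HasValue w q (j : ℕ)) :
    pair w y ∈ (finPart k f).toProblem.dom ∧
      ∀ z ∈ (finPart k f).toProblem (pair w y), ∃ j ∈ s, z 0 = (j : ℕ) := by
  refine ⟨?_, ?_⟩
  · obtain ⟨q, hq⟩ := hy
    obtain ⟨j, -, hj⟩ := h q hq
    refine ⟨fun _ => j, j, ⟨w, y, rfl, fun q hq => ?_, q, hq, hj⟩, rfl⟩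
    obtain ⟨i, -, hi⟩ := h q hq
    exact ⟨i, i.2, hi⟩
  · rintro z ⟨j, ⟨w', y', he, -, q, hq, hj⟩, hz⟩
    obtain ⟨rfl, rfl⟩ := pair_inj.1 he
    obtain ⟨i, hi, hi'⟩ := h q hq
    exact ⟨i, hi, hz.trans (hj.unique hi')⟩

theorem FinProblem.reducible_finPart {k : ℕ} {g : FinProblem k} {f : Problem}
    (h : g.toProblem ≤W f) : g.toProblem ≤W (finPart k f).toProblem := by
  obtain ⟨H, K, hH, hK, h⟩ := reducible_iff.1 h
  obtain ⟨H', hH', hcode⟩ := exists_code hH hK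
  refine reducible_iff.2 ⟨H', _, hH', computableFunctional_left, fun p hp => ?_⟩
  obtain ⟨y, hy, hyf, hsol⟩ := h p hp
  obtain ⟨w, hw, hval⟩ := hcode p y hy
  obtain ⟨hdom, hsol'⟩ := finPart_solution (s := g p) (w := w) hyf fun q hq => by
    obtain ⟨u, hu, j, hj, hju⟩ := hsol q hq
    exact ⟨j, hj, hju ▸ hval q u hu⟩
  exact ⟨_, hw, hdom, fun z hz => ⟨z, mem_left z p, hsol' z hz⟩⟩

/-- The argument for fixed `k` goes through with `k` as part of the input, because the code is
computed from `⟨k, p⟩`. -/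
theorem FiberReducible.finPart {g : ∀ k, FinProblem k} {f : Problem}
    (h : FiberReducible (fun k => (g k).toProblem) fun _ => f) :
    FiberReducible (fun k => (g k).toProblem) fun k => (finPart k f).toProblem := by
  obtain ⟨H, K, hH, hK, h⟩ := h
  obtain ⟨H', hH', hcode⟩ := exists_code hH hK
  refine ⟨H', _, hH', computableFunctional_left, fun k p hp => ?_⟩
  obtain ⟨y, hy, hyf, hsol⟩ := h k p hp
  obtain ⟨w, hw, hval⟩ := hcode _ y hy
  obtain ⟨hdom, hsol'⟩ := finPart_solution (s := g k p) (w := w) hyf fun q hq => by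
    obtain ⟨u, hu, j, hj, hju⟩ := hsol q hq
    exact ⟨j, hj, hju ▸ hval q u hu⟩
  exact ⟨_, hw, hdom, fun z hz => ⟨z, mem_left z _, hsol' z hz⟩⟩

theorem isGreatestFin_finPart (k : ℕ) (f : Problem) :
    IsGreatestFin k f (finPart k f).toProblem :=
  ⟨⟨finPart k f, .refl _, .refl _⟩, finPart_reducible k f, fun _ => FinProblem.reducible_finPart⟩

/-! ### Recurring colours as a closed set in the limit -/

/-- The point `1^j 0^ω` of Cantor space. -/
def unary (j : ℕ) : ℕ → Bool := fun n => decide (n < j)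

/-- The number of the first place where `z` vanishes, searched for in `⟨z, x⟩`. -/
def zeroSearch (σ : List ℕ) (_ : ℕ) : Option ℕ :=
  if σ.length % 2 = 1 ∧ σ.getD (σ.length - 1) 1 = 0 then some (σ.length / 2) else none

theorem primrec_zeroSearch : Primrec₂ zeroSearch := by
  have hl : Primrec fun a : List ℕ × ℕ => a.1.length := Primrec.list_length.comp Primrec.fst
  refine Primrec.ite (PrimrecPred.and ?_ ?_) (Primrec.option_some.comp
    (Primrec.nat_div.comp hl (Primrec.const 2))) (Primrec.const none)
  · exact PrimrecRel.comp Primrec.eq (Primrec.nat_mod.comp hl (Primrec.const 2)) (Primrec.const 1)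
  · exact PrimrecRel.comp Primrec.eq ((Primrec.list_getD 1).comp Primrec.fst
      (Primrec.pred.comp hl)) (Primrec.const 0)

/-- A prefix of length `2 * m + 1` ends in `z m`, so each odd length tests one place and the first
hit is the least zero. -/
theorem zeroSearch_approximates {z x : Baire} {l : ℕ} (h : z l = 0) (hmin : ∀ m < l, z m ≠ 0) :
    Approximates zeroSearch (pair z x) fun _ => l := by
  have hlast : ∀ m, (initSeg (pair z x) (2 * m + 1)).getD (2 * m) 1 = z m := fun m => by
    rw [getD_initSeg _ (by omega), pair_even]
  refine fun n => ⟨2 * l + 1, ?_, fun m' hm' => if_neg ?_⟩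
  · have h1 : (2 * l + 1) % 2 = 1 := by omega
    have h2 : (2 * l + 1) / 2 = l := by omega
    simp only [zeroSearch, length_initSeg, h1, h2, Nat.add_sub_cancel, hlast, h, and_self, if_true]
  · rintro ⟨h1, h2⟩
    rw [length_initSeg] at h1 h2
    obtain ⟨m, rfl⟩ : ∃ m, m' = 2 * m + 1 := ⟨m' / 2, by omega⟩
    rw [Nat.add_sub_cancel, hlast] at h2
    exact hmin m (by omega) h2

/-- For `a = ⟨j, N⟩`, the code of a word that is to be removed unless `b`, where `b` says that the
colour `j` occurs after stage `N`. -/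
def removal (k a : ℕ) (b : Prop) [Decidable b] : ℕ :=
  if a.unpair.1 < k then
    if b then 0 else Encodable.encode (initSeg (unary a.unpair.1) (a.unpair.1 + 1)) + 1
  else Encodable.encode (initSeg (unary k) k) + 1

/-- Removing the cylinder of `1^k` leaves the points whose first zero is at some `j < k`. These fall
into the disjoint cylinders of `1^j 0`, each removed exactly when some `N` fails for `j`. -/
theorem mem_closedSet_removal_iff {k : ℕ} {b : ℕ → ℕ → Prop}
    [∀ j N, Decidable (b j N)] {x : ℕ → Bool} :
    (x ∈ closedSet fun a => removal k a (b a.unpair.1 a.unpair.2)) ↔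
      ∃ j < k, initSeg x (j + 1) = initSeg (unary j) (j + 1) ∧ ∀ N, b j N := by
  constructor
  · intro hx
    have hk : ∃ j, j < k ∧ x j = false := by
      by_contra! hk
      refine hx (Nat.pair k 0) (initSeg (unary k) k) (by simp [removal]) ?_
      rw [length_initSeg]
      exact initSeg_congr fun i hi => by simpa [unary, hi] using hk i hi
    classical
    obtain ⟨hj, hxj⟩ := Nat.find_spec hk
    have hmin := fun i hi => Nat.find_min hk (m := i) hi
    set j := Nat.find hk
    have heq : initSeg x (j + 1) = initSeg (unary j) (j + 1) := initSeg_congr fun i hi => by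
      rcases Nat.lt_succ_iff_lt_or_eq.1 hi with h | rfl
      · have := hmin i h
        simp only [not_and, Bool.not_eq_false] at this
        simp [unary, h, this (by omega)]
      · simp [unary, hxj]
    refine ⟨j, hj, heq, fun N => ?_⟩
    by_contra hb
    refine hx (Nat.pair j N) (initSeg (unary j) (j + 1)) (by simp [removal, hj, hb]) ?_
    rwa [length_initSeg]
  · rintro ⟨j, hj, hx, hb⟩ a σ ha he
    have hxj : ∀ i < j + 1, x i = unary j i := initSeg_eq_iff.1 hx
    beta_reduce at ha
    unfold removal at ha
    split_ifs at ha with h1 h2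
    · rw [Nat.add_right_cancel_iff, Encodable.encode_inj] at ha
      rw [← ha, length_initSeg, initSeg_eq_iff] at he
      -- `1^a 0` and `1^j 0` with `a ≠ j` disagree at the smaller of the two places.
      rcases lt_trichotomy a.unpair.1 j with h | h | h
      · have := he a.unpair.1 (by omega)
        rw [hxj _ (by omega)] at this
        simp [unary, h] at this
      · rw [h] at h2; exact h2 (hb _)
      · have := he j (by omega)
        rw [hxj _ (by omega)] at this
        simp [unary, h] at this
    · rw [Nat.add_right_cancel_iff, Encodable.encode_inj] at ha
      rw [← ha, length_initSeg, initSeg_eq_iff] at he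
      have := he j hj
      rw [hxj _ (by omega)] at this
      simp [unary, hj] at this

theorem primrec_encode_unary : Primrec₂ fun j n => Encodable.encode (initSeg (unary j) n) := by
  refine Primrec.encode.comp (Primrec.list_map (Primrec.list_range.comp Primrec.snd) ?_)
  exact (PrimrecRel.comp Primrec.nat_lt Primrec.snd
    (Primrec.fst.comp Primrec.fst)).decide.to₂

/-- The stages of the approximation of the closed set of the `1^j 0…` with `j` a colour
that occurs infinitely often. -/
def colourStage (x : Baire) (c : ℕ) : ℕ :=
  removal (x 0) c.unpair.2 (∃ n < c.unpair.1, c.unpair.2.unpair.2 ≤ n ∧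
    x (n + 1) = c.unpair.2.unpair.1)

theorem computableFunctional_colourStage :
    ComputableFunctional fun x => Part.some (colourStage x) := by
  refine computableFunctional_of_use (fun c => c.unpair.1 + 1) (fun σ c => removal (σ.getD 0 0)
    c.unpair.2 (∃ n < c.unpair.1, c.unpair.2.unpair.2 ≤ n ∧ σ.getD (n + 1) 0 = c.unpair.2.unpair.1))
    (Primrec.succ.comp (Primrec.fst.comp Primrec.unpair)) ?_ fun x c => ?_
  · have hi : Primrec fun a : List ℕ × ℕ => a.2.unpair.1 :=
      Primrec.fst.comp (Primrec.unpair.comp Primrec.snd)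
    have ha : Primrec fun a : List ℕ × ℕ => a.2.unpair.2.unpair :=
      Primrec.unpair.comp (Primrec.snd.comp (Primrec.unpair.comp Primrec.snd))
    have hk : Primrec fun a : List ℕ × ℕ => a.1.getD 0 0 :=
      (Primrec.list_getD 0).comp Primrec.fst (Primrec.const 0)
    have hR : PrimrecRel fun (n : ℕ) (a : List ℕ × ℕ) =>
        a.2.unpair.2.unpair.2 ≤ n ∧ a.1.getD (n + 1) 0 = a.2.unpair.2.unpair.1 :=
      PrimrecPred.and
        (PrimrecRel.comp Primrec.nat_le (Primrec.snd.comp (ha.comp Primrec.snd)) Primrec.fst)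
        (PrimrecRel.comp Primrec.eq ((Primrec.list_getD 0).comp (Primrec.fst.comp Primrec.snd)
          (Primrec.succ.comp Primrec.fst)) (Primrec.fst.comp (ha.comp Primrec.snd)))
    have hj := Primrec.fst.comp ha
    exact (Primrec.ite (PrimrecRel.comp Primrec.nat_lt hj hk)
      (Primrec.ite (primrecPred_exists_lt hR hi) (Primrec.const 0)
        (Primrec.succ.comp (primrec_encode_unary.comp hj (Primrec.succ.comp hj))))
      (Primrec.succ.comp (primrec_encode_unary.comp hk hk))).to_comp
  · have h0 := getD_initSeg x (Nat.succ_pos c.unpair.1) 0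
    unfold colourStage
    congr 1
    · exact h0.symm
    · refine propext (exists_congr fun n => and_congr_right fun hn => ?_)
      rw [getD_initSeg x (by omega)]

/-- A bounded search for a late occurrence changes its answer at most once as the bound grows, so
every entry stabilizes. -/
theorem tendsto_colourStage (x : Baire) [∀ j N, Decidable (∃ n, N ≤ n ∧ x (n + 1) = j)] :
    Tendsto (fun i a => colourStage x (Nat.pair i a)) atTop
      (𝓝 fun a => removal (x 0) a (∃ n, a.unpair.2 ≤ n ∧ x (n + 1) = a.unpair.1)) := by
  rw [tendsto_pi_nhds]
  intro a
  refine tendsto_nhds_of_eventually_eq ?_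
  simp only [colourStage, Nat.unpair_pair]
  by_cases h : ∃ n, a.unpair.2 ≤ n ∧ x (n + 1) = a.unpair.1
  · obtain ⟨n, hn⟩ := id h
    filter_upwards [eventually_gt_atTop n] with i hi
    congr 1
    exact propext ⟨fun _ => h, fun _ => ⟨n, hi, hn⟩⟩
  · refine Eventually.of_forall fun i => ?_
    congr 1
    exact propext ⟨fun ⟨n, _, hn⟩ => ⟨n, hn⟩, fun h' => absurd h' h⟩

theorem mem_jump_iff {f : Problem} {p x q : Baire}
    (h : Tendsto (fun (i : ℕ) (n : ℕ) => p (Nat.pair i n)) atTop (𝓝 x)) :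
    q ∈ jump f p ↔ q ∈ f x :=
  ⟨fun ⟨_, h', hq⟩ => tendsto_nhds_unique h' h ▸ hq, fun hq => ⟨x, h, hq⟩⟩

theorem fiberReducible_cRT_jump :
    FiberReducible (fun k => (cRT k).toProblem) fun _ => jump closedChoiceCantor := by
  refine ⟨_, _, computableFunctional_colourStage,
    computableFunctional_searchFunctional primrec_zeroSearch.to_comp, ?_⟩
  rintro k p ⟨-, j, ⟨hp, hj⟩, -⟩
  classical
  have hlim := tendsto_colourStage (cons k p)
  have hiff : ∀ {x}, _ := fun {x} => mem_closedSet_removal_iff (k := k) (x := x)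
    (b := fun j N => ∃ n, N ≤ n ∧ cons k p (n + 1) = j)
  refine ⟨_, Part.mem_some _, ?_, fun z hz => ?_⟩
  · refine ⟨_, (mem_jump_iff hlim).2 ⟨unary j, hiff.2
      ⟨j, j.2, rfl, fun N => ?_⟩, rfl⟩⟩
    obtain ⟨n, hn, h⟩ := frequently_atTop.1 hj N
    exact ⟨n, hn, h⟩
  · obtain ⟨x, hx, rfl⟩ := (mem_jump_iff hlim).1 hz
    obtain ⟨i, hi, hxi, hb⟩ := hiff.1 hx
    rw [initSeg_eq_iff] at hxi
    refine ⟨_, mem_searchFunctional.2 (zeroSearch_approximates (l := i) ?_ fun m hm => ?_),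
      ⟨i, hi⟩, ⟨hp, frequently_atTop.2 hb⟩, rfl⟩
    · simp [hxi i (by omega), unary]
    · simp [hxi m (by omega), unary, hm]

/-! ### Compactness: exclusion of a value is seen at a finite level -/

/-- All words of length `n` over `{0, 1}`. -/
def boolWords (n : ℕ) : List (List Bool) :=
  Nat.rec [[]] (fun _ l => l.flatMap fun ρ => [false :: ρ, true :: ρ]) n

theorem mem_boolWords {n : ℕ} {ρ : List Bool} : ρ ∈ boolWords n ↔ ρ.length = n := by
  induction n generalizing ρ with
  | zero => simp [boolWords]
  | succ n ih =>
    have : boolWords (n + 1) = (boolWords n).flatMap fun ρ => [false :: ρ, true :: ρ] := rfl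
    rw [this]
    cases ρ with
    | nil => simp
    | cons b ρ => cases b <;> simp [ih]

theorem primrec_boolWords : Primrec boolWords := by
  refine Primrec.nat_rec₁ _ (Primrec.list_flatMap Primrec.snd ?_)
  have hcons : ∀ b : Bool, Primrec fun a : (ℕ × List (List Bool)) × List Bool => b :: a.2 :=
    fun b => Primrec.list_cons.comp (Primrec.const b) Primrec.snd
  exact Primrec.list_cons.comp (hcons false)
    (Primrec.list_cons.comp (hcons true) (Primrec.const []))

/-- A point of Cantor space as a point of Baire space. -/
def toBaire (x : ℕ → Bool) : Baire := fun n => (x n).toNat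

/-- The extension of a word by zeros. -/
def extend (ρ : List Bool) : ℕ → Bool := fun i => ρ.getD i false

theorem initSeg_extend {ρ : List Bool} {n : ℕ} (h : ρ.length = n) :
    initSeg (extend ρ) n = ρ := by
  subst h
  refine List.ext_getElem? fun i => ?_
  rcases lt_or_ge i ρ.length with hi | hi
  · rw [getElem?_initSeg _ hi, extend, List.getD_eq_getElem?_getD, List.getElem?_eq_getElem hi,
      Option.getD_some]
  · rw [List.getElem?_eq_none (by simpa using hi), List.getElem?_eq_none hi]

/-- From the finite parts `τ` of negative information and `u` of the code of a functional it can
be seen that the functional does not have the value `j` at `x`, looking only at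
initial segments of `x` up to length `n`, or that `x` is not in the closed set. -/
def Avoids (j : ℕ) (u τ : List ℕ) (n : ℕ) (x : ℕ → Bool) : Prop :=
  (∃ m < n + 1, Encodable.encode (initSeg x m) + 1 ∈ τ) ∨
    ∃ m < n + 1, (u.getD (Encodable.encode (initSeg (toBaire x) m)) 0 ≠ 0 ∧
      u.getD (Encodable.encode (initSeg (toBaire x) m)) 0 ≠ j + 1) ∧
      ∀ m' < m, u[Encodable.encode (initSeg (toBaire x) m')]? = some 0

theorem Avoids.congr {j : ℕ} {u τ : List ℕ} {n : ℕ} {x y : ℕ → Bool}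
    (h : initSeg x n = initSeg y n) (hx : Avoids j u τ n x) : Avoids j u τ n y := by
  rw [initSeg_eq_iff] at h
  have h1 : ∀ m < n + 1, initSeg x m = initSeg y m := fun m hm =>
    initSeg_congr fun i hi => h i (by omega)
  have h2 : ∀ m < n + 1, initSeg (toBaire x) m = initSeg (toBaire y) m := fun m hm =>
    initSeg_congr fun i hi => by rw [toBaire, toBaire, h i (by omega)]
  refine hx.imp ?_ ?_
  · rintro ⟨m, hm, hmem⟩
    exact ⟨m, hm, h1 m hm ▸ hmem⟩
  · rintro ⟨m, hm, hne, hmin⟩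
    refine ⟨m, hm, h2 m hm ▸ hne, fun m' hm' => ?_⟩
    rw [← h2 m' (by omega)]
    exact hmin m' hm'

theorem Avoids.mono {j : ℕ} {u u' τ τ' : List ℕ} {n n' : ℕ} {x : ℕ → Bool} (hu : u <+: u')
    (hτ : τ <+: τ') (hn : n ≤ n') (h : Avoids j u τ n x) : Avoids j u' τ' n' x := by
  have hget : ∀ i v, u[i]? = some v → u'[i]? = some v := fun i v hv => by
    obtain ⟨ρ, rfl⟩ := hu
    rwa [List.getElem?_append_left]
    by_contra hi
    simp [List.getElem?_eq_none (not_lt.1 hi)] at hv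
  refine h.imp ?_ ?_
  · rintro ⟨m, hm, hmem⟩
    exact ⟨m, by omega, hτ.subset hmem⟩
  · rintro ⟨m, hm, hne, hmin⟩
    refine ⟨m, by omega, ?_, fun m' hm' => hget _ _ (hmin m' hm')⟩
    rw [List.getD_eq_getElem?_getD] at hne ⊢
    rcases hv : u[Encodable.encode (initSeg (toBaire x) m)]? with _ | v
    · simp [hv] at hne
    · rwa [hget _ _ hv, ← hv]

theorem Avoids.not_hasValue {j n : ℕ} {w y : Baire} {x : ℕ → Bool}
    (h : Avoids j (initSeg w n) (initSeg y n) n x) (hx : x ∈ closedSet y) :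
    ¬ HasValue w (toBaire x) j := by
  intro hj
  rcases h with ⟨m, -, hmem⟩ | ⟨m, -, hne, hmin⟩
  · obtain ⟨l, -, hl⟩ := List.mem_map.1 hmem
    exact hx l _ hl (by rw [length_initSeg])
  · have hc : ∀ c, (initSeg w n).getD c 0 ≠ 0 → (initSeg w n).getD c 0 = w c := fun c hc => by
      by_cases h : c < n
      · exact getD_initSeg _ h 0
      · rw [List.getD_eq_getElem?_getD, List.getElem?_eq_none (by simpa using h)] at hc
        simp at hc
    have hc' : ∀ c, (initSeg w n)[c]? = some 0 → w c = 0 := fun c hc => by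
      by_cases h : c < n
      · rw [getElem?_initSeg _ h] at hc
        exact Option.some.inj hc
      · rw [List.getElem?_eq_none (by simpa using h)] at hc
        simp at hc
    rw [hc _ hne.1] at hne
    have : HasValue w (toBaire x) (w (Encodable.encode (initSeg (toBaire x) m)) - 1) :=
      ⟨m, by omega, fun m' hm' => hc' _ (hmin m' hm')⟩
    have := this.unique hj
    omega

/-- Either a removed cylinder contains `x`, or the functional takes a wrong value at `x`; both are
witnessed by finitely many entries. -/
theorem exists_avoids {j : ℕ} {w y : Baire} {x : ℕ → Bool}
    (h : x ∈ closedSet y → ∃ i ≠ j, HasValue w (toBaire x) i) :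
    ∃ n, Avoids j (initSeg w n) (initSeg y n) n x := by
  by_cases hx : x ∈ closedSet y
  · obtain ⟨i, hij, m, hm, hmin⟩ := h hx
    obtain ⟨n, hn, hmn⟩ : ∃ n, (∀ m' ∈ Finset.range (m + 1),
        Encodable.encode (initSeg (toBaire x) m') < n) ∧ m ≤ n :=
      (((Filter.eventually_all_finset _).2 fun _ _ => eventually_gt_atTop _).and
        (eventually_ge_atTop _)).exists
    refine ⟨n, .inr ⟨m, by omega, ?_, fun m' hm' => ?_⟩⟩
    · rw [getD_initSeg _ (hn m (by simp)), hm]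
      omega
    · rw [getElem?_initSeg _ (hn m' (by simp; omega)), hmin m' hm']
  · simp only [closedSet, Set.mem_ofPred_eq, not_forall, not_not] at hx
    obtain ⟨l, σ, hl, hσ⟩ := hx
    refine ⟨max (l + 1) σ.length, .inl ⟨σ.length, by omega, ?_⟩⟩
    rw [hσ, ← hl]
    exact List.mem_map.2 ⟨l, List.mem_range.2 (by omega), rfl⟩

theorem isOpen_of_initSeg {s : Set (ℕ → Bool)} (n : ℕ)
    (h : ∀ x y, initSeg x n = initSeg y n → x ∈ s → y ∈ s) : IsOpen s := by
  have hcont : Continuous fun (x : ℕ → Bool) (i : Fin n) => x i :=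
    continuous_pi fun i => continuous_apply _
  have : s = (fun (x : ℕ → Bool) (i : Fin n) => x i) ⁻¹'
      ((fun (x : ℕ → Bool) (i : Fin n) => x i) '' s) := by
    refine Set.Subset.antisymm (Set.subset_preimage_image _ _) ?_
    rintro y ⟨x, hx, hxy⟩
    exact h x y (initSeg_congr fun i hi => congrFun hxy ⟨i, hi⟩) hx
  rw [this]
  exact (isOpen_discrete _).preimage hcont

/-- The points dealt with at level `n` form an increasing sequence of open sets covering Cantor
space, so compactness yields one level for all points. -/
theorem exists_forall_avoids {j : ℕ} {w y : Baire}
    (h : ∀ x, ∃ n, Avoids j (initSeg w n) (initSeg y n) n x) :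
    ∃ n, ∀ x, Avoids j (initSeg w n) (initSeg y n) n x := by
  have hmono : Monotone fun n => {x | Avoids j (initSeg w n) (initSeg y n) n x} :=
    fun m n hmn x hx => Avoids.mono (initSeg_prefix w hmn) (initSeg_prefix y hmn) hmn hx
  obtain ⟨n, hn⟩ := isCompact_univ.elim_directed_cover
    (fun n => {x | Avoids j (initSeg w n) (initSeg y n) n x})
    (fun n => isOpen_of_initSeg n fun x y hxy hx => hx.congr hxy)
    (fun x _ => Set.mem_iUnion.2 (h x)) hmono.directed_le
  exact ⟨n, fun x => hn (Set.mem_univ x)⟩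

/-- It can be seen from `u` and `τ` that no point has value `j`. -/
def Excluded (j : ℕ) (u τ : List ℕ) : Prop :=
  ∀ ρ ∈ boolWords u.length, Avoids j u τ u.length (extend ρ)

/-- `Avoids` at level `n` depends only on the first `n` bits, so finitely many words represent all
points. This makes exclusion decidable. -/
theorem excluded_iff {j : ℕ} {u τ : List ℕ} :
    Excluded j u τ ↔ ∀ x, Avoids j u τ u.length x := by
  refine ⟨fun h x => ?_, fun h ρ _ => h _⟩
  exact (h (initSeg x u.length) (mem_boolWords.2 (length_initSeg _ _))).congr
    (initSeg_extend (length_initSeg _ _))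

theorem primrec_extend : Primrec₂ extend :=
  Primrec.list_getD false

theorem primrecPred_excluded {α : Type} [Primcodable α] {f : α → ℕ} {g h : α → List ℕ}
    (hf : Primrec f) (hg : Primrec g) (hh : Primrec h) :
    PrimrecPred fun a => Excluded (f a) (g a) (h a) := by
  -- the word, the index of the colour and the two finite parts
  let β := List Bool × ℕ × List ℕ × List ℕ
  have hcode : Primrec₂ fun (m : ℕ) (b : β) => Encodable.encode (initSeg (extend b.1) m) :=
    Primrec.encode.comp (Primrec.list_map (Primrec.list_range.comp Primrec.fst)
      (primrec_extend.comp (Primrec.fst.comp (Primrec.snd.comp Primrec.fst)) Primrec.snd).to₂)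
  have hcode' : Primrec₂ fun (m : ℕ) (b : β) =>
      Encodable.encode (initSeg (toBaire (extend b.1)) m) :=
    Primrec.encode.comp (Primrec.list_map (Primrec.list_range.comp Primrec.fst)
      ((Primrec.dom_bool Bool.toNat).comp
        (primrec_extend.comp (Primrec.fst.comp (Primrec.snd.comp Primrec.fst)) Primrec.snd)).to₂)
  have hmem : PrimrecRel fun (c : ℕ) (τ : List ℕ) => c ∈ τ :=
    ((Primrec.eq (α := ℕ)).exists_mem_list.comp Primrec.snd Primrec.fst).of_eq (by simp)
  have hj : Primrec fun b : β => b.2.1 := Primrec.fst.comp Primrec.snd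
  have hu : Primrec fun b : β => b.2.2.1 := Primrec.fst.comp (Primrec.snd.comp Primrec.snd)
  have hτ : Primrec fun b : β => b.2.2.2 := Primrec.snd.comp (Primrec.snd.comp Primrec.snd)
  have h1 : PrimrecRel fun (m : ℕ) (b : β) =>
      Encodable.encode (initSeg (extend b.1) m) + 1 ∈ b.2.2.2 :=
    hmem.comp (Primrec.succ.comp hcode) (hτ.comp Primrec.snd)
  have h2 : Primrec₂ fun (m : ℕ) (b : β) =>
      b.2.2.1.getD (Encodable.encode (initSeg (toBaire (extend b.1)) m)) 0 :=
    (Primrec.list_getD 0).comp (hu.comp Primrec.snd) hcode'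
  have h3 : PrimrecRel fun (m' : ℕ) (a : ℕ × β) =>
      a.2.2.2.1[Encodable.encode (initSeg (toBaire (extend a.2.1)) m')]? = some 0 :=
    PrimrecRel.comp Primrec.eq (Primrec.list_getElem?.comp
      (hu.comp (Primrec.snd.comp Primrec.snd))
      (hcode'.comp Primrec.fst (Primrec.snd.comp Primrec.snd))) (Primrec.const (some 0))
  have h4 : PrimrecRel fun (m : ℕ) (b : β) =>
      (b.2.2.1.getD (Encodable.encode (initSeg (toBaire (extend b.1)) m)) 0 ≠ 0 ∧
      b.2.2.1.getD (Encodable.encode (initSeg (toBaire (extend b.1)) m)) 0 ≠ b.2.1 + 1) ∧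
      ∀ m' < m, b.2.2.1[Encodable.encode (initSeg (toBaire (extend b.1)) m')]? = some 0 :=
    PrimrecPred.and (PrimrecPred.and (PrimrecRel.comp Primrec.eq h2 (Primrec.const 0)).not
      (PrimrecRel.comp Primrec.eq h2 (Primrec.succ.comp (hj.comp Primrec.snd))).not)
      (primrecPred_forall_lt h3 Primrec.fst)
  have hlen : Primrec fun b : β => b.2.2.1.length + 1 :=
    Primrec.succ.comp (Primrec.list_length.comp hu)
  have h5 : PrimrecPred fun b : β => Avoids b.2.1 b.2.2.1 b.2.2.2 b.2.2.1.length (extend b.1) :=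
    (primrecPred_exists_lt h1 hlen).or (primrecPred_exists_lt h4 hlen)
  have h6 : PrimrecRel fun (ρ : List Bool) (b : ℕ × List ℕ × List ℕ) =>
      Avoids b.1 b.2.1 b.2.2 b.2.1.length (extend ρ) := h5
  exact h6.forall_mem_list.comp (primrec_boolWords.comp (Primrec.list_length.comp hg))
    (hf.pair (hg.pair hh))

/-! ### Colouring by the value that survives longest -/

/-- The least place below `k` where `e` is maximal. -/
def leader (e : ℕ → ℕ) (k : ℕ) : ℕ :=
  (List.range k).findIdx fun j => decide (∀ j' < k, e j' ≤ e j)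

theorem leader_spec (e : ℕ → ℕ) {k : ℕ} (hk : 0 < k) :
    leader e k < k ∧ ∀ j < k, e j ≤ e (leader e k) := by
  have hlt : leader e k < (List.range k).length := by
    obtain ⟨j, hj, hmax⟩ := Finset.exists_max_image (Finset.range k) e ⟨0, by simpa using hk⟩
    refine List.findIdx_lt_length_of_exists ⟨j, by simpa using hj, ?_⟩
    simpa using hmax
  rw [List.length_range] at hlt
  refine ⟨hlt, ?_⟩
  have hget : (List.range k)[leader e k]? = some (leader e k) := by simp [hlt]
  simpa using List.findIdx_of_getElem?_eq_some hget

open Classical in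
/-- The least `n ≤ i` with `R n`, or `i + 1`. -/
noncomputable def level (R : ℕ → Prop) (i : ℕ) : ℕ :=
  (List.range (i + 1)).findIdx fun n => decide (R n)

theorem level_le {R : ℕ → Prop} {i n : ℕ} (h : R n) : level R i ≤ n := by
  by_contra! hlt
  have := List.not_of_lt_findIdx hlt
  simp [h] at this

theorem level_congr {R R' : ℕ → Prop} {i : ℕ} (h : ∀ n ≤ i, (R n ↔ R' n)) :
    level R i = level R' i := by
  refine le_antisymm (List.findIdx_le_findIdx fun n hn => ?_)
    (List.findIdx_le_findIdx fun n hn => ?_)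
  all_goals
    have := h n (by simpa [Nat.lt_succ_iff] using hn)
    simp [this]

theorem lt_level {R : ℕ → Prop} {i N : ℕ} (hN : N ≤ i) (h : ∀ n ≤ N, ¬ R n) :
    N < level R i := by
  classical
  refine List.lt_findIdx_of_not (by simp; omega) fun n hn => ?_
  simpa using h n hn

/-- The part of length `n` of the code of a functional, read off from `⟨k, ⟨w, p⟩⟩`. -/
def codePart (σ : List ℕ) (n : ℕ) : List ℕ :=
  (List.range n).map fun l => σ.getD (2 * l + 1) 0

/-- The part of length `n` of the `i`-th member of the sequence coded by `p`, read off
from `⟨k, ⟨w, p⟩⟩`. -/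
def stagePart (σ : List ℕ) (i n : ℕ) : List ℕ :=
  (List.range n).map fun l => σ.getD (2 * Nat.pair i l + 2) 0

/-- The leading `k` shifts everything by one: `w` sits on odd places and `p` on positive even ones.
-/
theorem codePart_initSeg {k : ℕ} {w p : Baire} {s n : ℕ} (h : 2 * n ≤ s) :
    codePart (initSeg (cons k (pair w p)) s) n = initSeg w n := by
  refine List.map_congr_left fun l hl => ?_
  have := List.mem_range.1 hl
  rw [getD_initSeg _ (by omega), cons_succ, pair_even]

theorem stagePart_initSeg {k : ℕ} {w p : Baire} {s i n : ℕ}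
    (h : ∀ l < n, 2 * Nat.pair i l + 2 < s) :
    stagePart (initSeg (cons k (pair w p)) s) i n = initSeg (fun l => p (Nat.pair i l)) n := by
  refine List.map_congr_left fun l hl => ?_
  rw [getD_initSeg _ (h l (List.mem_range.1 hl)), cons_succ, pair_odd]

/-- The colour at stage `i`: the one that takes longest to be excluded. -/
noncomputable def stageColour (σ : List ℕ) (i : ℕ) : ℕ :=
  leader (fun j => level (fun n => Excluded j (codePart σ n) (stagePart σ i n)) i) (σ.getD 0 0)

theorem primrec_stageColour : Primrec₂ stageColour := by
  have hcode : Primrec₂ codePart :=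
    Primrec.list_map (Primrec.list_range.comp Primrec.snd)
      ((Primrec.list_getD 0).comp (Primrec.fst.comp Primrec.fst)
        (primrec_double_add_one.comp Primrec.snd)).to₂
  have hstage : Primrec fun a : List ℕ × ℕ × ℕ => stagePart a.1 a.2.1 a.2.2 :=
    Primrec.list_map (Primrec.list_range.comp (Primrec.snd.comp Primrec.snd))
      ((Primrec.list_getD 0).comp (Primrec.fst.comp Primrec.fst)
        (Primrec.succ.comp (primrec_double_add_one.comp (Primrec₂.natPair.comp
          (Primrec.fst.comp (Primrec.snd.comp Primrec.fst)) Primrec.snd)))).to₂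
  classical
  have hlevel : Primrec₂ fun (j : ℕ) (a : List ℕ × ℕ) =>
      level (fun n => Excluded j (codePart a.1 n) (stagePart a.1 a.2 n)) a.2 := by
    refine Primrec.list_findIdx (Primrec.list_range.comp
      (Primrec.succ.comp (Primrec.snd.comp Primrec.snd))) ?_
    have hσ : Primrec fun b : (ℕ × List ℕ × ℕ) × ℕ => b.1.2.1 :=
      Primrec.fst.comp (Primrec.snd.comp Primrec.fst)
    have hi : Primrec fun b : (ℕ × List ℕ × ℕ) × ℕ => b.1.2.2 :=
      Primrec.snd.comp (Primrec.snd.comp Primrec.fst)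
    exact (primrecPred_excluded (Primrec.fst.comp Primrec.fst) (hcode.comp hσ Primrec.snd)
      (hstage.comp (hσ.pair (hi.pair Primrec.snd)))).decide
  have hk : Primrec fun a : List ℕ × ℕ => a.1.getD 0 0 :=
    (Primrec.list_getD 0).comp Primrec.fst (Primrec.const 0)
  refine Primrec.list_findIdx (Primrec.list_range.comp hk) ?_
  have hle : PrimrecRel fun (j' : ℕ) (b : (List ℕ × ℕ) × ℕ) =>
      level (fun n => Excluded j' (codePart b.1.1 n) (stagePart b.1.1 b.1.2 n)) b.1.2 ≤
      level (fun n => Excluded b.2 (codePart b.1.1 n) (stagePart b.1.1 b.1.2 n)) b.1.2 :=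
    PrimrecRel.comp Primrec.nat_le (hlevel.comp Primrec.fst (Primrec.fst.comp Primrec.snd))
      (hlevel.comp (Primrec.snd.comp Primrec.snd) (Primrec.fst.comp Primrec.snd))
  exact (primrecPred_forall_lt hle (hk.comp Primrec.fst)).decide

/-- The sequence of colours computed from `⟨k, ⟨w, p⟩⟩`. -/
noncomputable def colouring (x : Baire) : Baire :=
  fun i => stageColour (initSeg x (2 * Nat.pair i i + 3)) i

theorem computableFunctional_colouring :
    ComputableFunctional fun x => Part.some (colouring x) :=
  computableFunctional_of_use (fun i => 2 * Nat.pair i i + 3) stageColour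
    (Primrec.succ.comp (Primrec.succ.comp (primrec_double_add_one.comp
      (Primrec₂.natPair.comp Primrec.id Primrec.id)))) primrec_stageColour.to_comp fun _ _ => rfl

/-- Stage `i` reads only entries `l < n ≤ i`, so the prefix of length `2 * Nat.pair i i + 3` covers
them and the truncation disappears. -/
theorem colouring_cons (k : ℕ) (w p : Baire) (i : ℕ) :
    colouring (cons k (pair w p)) i = leader (fun j => level (fun n =>
      Excluded j (initSeg w n) (initSeg (fun l => p (Nat.pair i l)) n)) i) k := by
  unfold colouring stageColour
  rw [getD_initSeg _ (by omega), cons_zero]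
  congr 1
  funext j
  refine level_congr fun n hn => ?_
  have hi : i ≤ Nat.pair i i := Nat.left_le_pair i i
  rw [codePart_initSeg (by omega), stagePart_initSeg fun l hl => ?_]
  have := Nat.pair_lt_pair_right i (show l < i by omega)
  omega

theorem eventually_initSeg_eq {u : ℕ → Baire} {y : Baire} (h : Tendsto u atTop (𝓝 y)) (n : ℕ) :
    ∀ᶠ i in atTop, initSeg (u i) n = initSeg y n := by
  have : ∀ᶠ i in atTop, ∀ l ∈ Finset.range n, u i l = y l := by
    rw [Filter.eventually_all_finset]
    intro l _
    have := tendsto_pi_nhds.1 h l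
    rw [nhds_discrete, tendsto_pure] at this
    exact this
  filter_upwards [this] with i hi
  exact initSeg_congr fun l hl => hi l (Finset.mem_range.2 hl)

/-- A colour that is a leader infinitely often is never excluded. -/
theorem not_excluded_of_frequently {k j i₀ : ℕ} {w p y : Baire}
    (hy : Tendsto (fun (i : ℕ) (n : ℕ) => p (Nat.pair i n)) atTop (𝓝 y)) (hk : i₀ < k)
    (h₀ : ∀ n, ¬ Excluded i₀ (initSeg w n) (initSeg y n))
    (hj : ∃ᶠ i in atTop, colouring (cons k (pair w p)) i = j) (n : ℕ) :
    ¬ Excluded j (initSeg w n) (initSeg y n) := by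
  intro hn
  -- Once the first `n` entries have settled, `j` has level at most `n` while `i₀` passes level `n`,
  -- so `j` cannot be the leader.
  refine hj ?_
  filter_upwards [eventually_initSeg_eq hy n, eventually_ge_atTop n] with i hi hni hij
  obtain ⟨-, hmax⟩ := leader_spec (fun j => level (fun n =>
    Excluded j (initSeg w n) (initSeg (fun l => p (Nat.pair i l)) n)) i) (i₀.zero_le.trans_lt hk)
  rw [← colouring_cons, hij] at hmax
  refine absurd (hmax i₀ hk) (not_le.2 ?_)
  refine lt_of_le_of_lt (level_le (n := n) ?_) (lt_level hni fun m hm => ?_)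
  · rwa [hi]
  · have : initSeg (fun l => p (Nat.pair i l)) m = initSeg y m := by
      rw [← take_initSeg _ hm, hi, take_initSeg _ hm]
    rw [this]
    exact h₀ m

theorem exists_frequently_eq {k : ℕ} {c : Baire} (hc : ∀ n, c n < k) :
    ∃ j : Fin k, ∃ᶠ n in atTop, c n = j := by
  obtain ⟨j, hj⟩ := Finite.exists_infinite_fiber fun n => (⟨c n, hc n⟩ : Fin k)
  refine ⟨j, Nat.frequently_atTop_iff_infinite.2 ?_⟩
  convert Set.infinite_coe_iff.1 hj using 1
  ext n
  simp [Fin.ext_iff]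

/-- A recurring colour is itself an attained value, so the backward functional just copies it. -/
theorem fiberReducible_finPart_cRT :
    FiberReducible (fun k => (finPart k (jump closedChoiceCantor)).toProblem)
      fun k => (cRT k).toProblem := by
  refine ⟨_, _, computableFunctional_colouring, computableFunctional_left, ?_⟩
  rintro k _ ⟨-, i₀, ⟨w, p, rfl, hw, q₀, ⟨y, hy, hq₀⟩, hi₀⟩, -⟩
  have hk : 0 < k := i₀.pos
  have hlt : ∀ i, colouring (cons k (pair w p)) i < k := fun i => by
    rw [colouring_cons]
    exact (leader_spec _ hk).1
  refine ⟨_, Part.mem_some _, ?_, ?_⟩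
  · obtain ⟨j, hj⟩ := exists_frequently_eq hlt
    exact ⟨fun _ => j, j, ⟨hlt, hj⟩, rfl⟩
  · rintro z ⟨j, ⟨-, hj⟩, hz⟩
    refine ⟨z, mem_left z _, j, ⟨w, p, rfl, hw, ?_⟩, hz⟩
    obtain ⟨x₀, hx₀, rfl⟩ := hq₀
    -- The given solution `i₀` is attained at `x₀` and hence never excluded; it is the competitor
    -- that beats excluded colours.
    have hne := not_excluded_of_frequently hy i₀.2 (fun n hn => by
      have := excluded_iff.1 hn x₀
      rw [length_initSeg] at this
      exact this.not_hasValue hx₀ hi₀) hj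
    -- If `j` were not attained, every point of the closed set would have another value, and
    -- compactness would exclude `j`.
    by_contra hcon
    obtain ⟨n, hn⟩ := exists_forall_avoids (j := j) (w := w) (y := y) fun x =>
      exists_avoids fun hx => by
        have hxj : toBaire x ∈ jump closedChoiceCantor p := ⟨y, hy, x, hx, rfl⟩
        obtain ⟨i, -, hi⟩ := hw _ hxj
        exact ⟨i, fun hij => hcon ⟨_, hxj, hij ▸ hi⟩, hi⟩
    exact hne n (excluded_iff.2 (by rwa [length_initSeg]))

/-! ### The equivalences -/

theorem finPart_jump_equivalent (k : ℕ) :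
    (finPart k (jump closedChoiceCantor)).toProblem ≡W (cRT k).toProblem :=
  ⟨fiberReducible_finPart_cRT.reducible k, fiberReducible_cRT_jump.finPart.reducible k⟩

theorem finitaryPart_jump_equivalent : finitaryPart (jump closedChoiceCantor) ≡W cRTPlus := by
  refine ⟨fiberReducible_finPart_cRT.disjointUnion ?_,
    fiberReducible_cRT_jump.finPart.disjointUnion fun _ _ _ => Set.mem_univ _⟩
  -- The fibre at `0` has no instances, so allowing `k = 0` in the union adds nothing.
  rintro k - ⟨-, -, j, -⟩
  exact j.pos

theorem cRT_reducible_of_le {k m : ℕ} (h : k ≤ m) :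
    (cRT k).toProblem ≤W (cRT m).toProblem := by
  refine .of_subset ?_ ?_
  · rintro p ⟨q, j, ⟨hp, hj⟩, hq⟩
    exact ⟨q, j.castLE h, ⟨fun n => (hp n).trans_le h, hj⟩, hq⟩
  · rintro p ⟨-, -, ⟨hp, -⟩, -⟩ q ⟨j, ⟨-, hj⟩, hq⟩
    obtain ⟨n, hn⟩ := hj.exists
    exact ⟨⟨j, hn ▸ hp n⟩, ⟨hp, hj⟩, hq⟩

/-- Names do not record the codomain, so `cRT (min k m)` counts as a problem with codomain `k` and
maximality applies. -/
theorem toProblem_castLE {l k : ℕ} (h : l ≤ k) (g : FinProblem l) :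
    FinProblem.toProblem (fun p => Fin.castLE h '' g p) = g.toProblem := by
  funext p
  ext q
  simp [FinProblem.toProblem]

theorem finPart_cRT_equivalent (k m : ℕ) :
    (finPart k (cRT m).toProblem).toProblem ≡W (cRT (min k m)).toProblem := by
  constructor
  · rcases le_total m k with h | h
    · rw [min_eq_right h]
      exact finPart_reducible k _
    -- For `k ≤ m` the reduction passes through the jump of closed choice, whose `k`-finitary part
    -- is already known to be `cRT k`.
    · rw [min_eq_left h]
      exact (FinProblem.reducible_finPart ((finPart_reducible k _).trans
        (fiberReducible_cRT_jump.reducible m))).trans (finPart_jump_equivalent k).1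
  · have := cRT_reducible_of_le (min_le_right k m)
    rw [← toProblem_castLE (min_le_left k m)] at this ⊢
    exact FinProblem.reducible_finPart this

end Weihrauch

open Weihrauch in
theorem mainTheorem6 :
    (∀ (k : ℕ) (f : Problem), IsGreatestFin k f (finPart k f).toProblem) ∧
    (∀ k : ℕ, (finPart k (jump closedChoiceCantor)).toProblem ≡W (cRT k).toProblem) ∧
    finitaryPart (jump closedChoiceCantor) ≡W cRTPlus ∧
    (∀ k m : ℕ, (finPart k (cRT m).toProblem).toProblem ≡W (cRT (min k m)).toProblem) :=
  ⟨isGreatestFin_finPart, finPart_jump_equivalent, finitaryPart_jump_equivalent,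
    finPart_cRT_equivalent⟩
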